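/- Let $\mathcal H$ be a real Hilbert space with inner product $(\cdot,\cdot)$ and norm $\|\cdot\|$, and let $L:\mathcal D(L)\subset\mathcal H\to\mathcal H$ be a linear operator which is maximal dissipative, i.e. $(Lv,v)\le 0$ for all $v\in\mathcal D(L)$ and $\mathcal R(I-kL)=\mathcal H$ for all $k>0$, and invertible, i.e. $L:\mathcal D(L)\to\mathcal H$ is bijective. Let $\{\mathrm e^{tL}\}_{t\ge 0}$ denote the strongly continuous semigroup generated by $L$. For every $h\in(0,h_{\max}]$ let $\mathcal H_h\subset\mathcal H$ be a finite dimensional subspace, equipped with its own inner product $(\cdot,\cdot)_h$ and induced norm $\|\cdot\|_h$ (also used for the operator norm), let $A_h,B_h:\mathcal H_h\to\mathcal H_h$ be linear operators, and put $L_h=A_h+B_h$. Let $s>0$ and $q\in\{0,1\}$ be fixed, and let $P_h:\mathcal D(P_h)\subset\mathcal H\to\mathcal H_h$ be mappings with $\mathcal D(L^q)\subset\mathcal D(P_h)$. Assume that there are constants $C_0,C_1,C_2>0$, independent of $h$, such that for all $h\in(0,h_{\max}]$: 1. $C_1\|v_h\|\le\|v_h\|_h\le C_2\|v_h\|$ for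 all $v_h\in\mathcal H_h$; 2. $\|P_hv-v\|\le C_0h^s\sum_{i=0}^q\|L^iv\|$ for all $v\in\mathcal D(L^q)$; 3. $(A_hv_h,v_h)_h\le 0$ and $(B_hv_h,v_h)_h\le 0$ for all $v_h\in\mathcal H_h$; 4. $L_h$ is invertible and $\|L_h^{-1}\|_h\le C_0$; 5. $\|L^{-1}v-L_h^{-1}P_hv\|\le C_0h^s\sum_{i=0}^q\|L^iv\|$ for all $v\in\mathcal D(L^q)$. Put $Q_h=L_h^{-1}P_hL:\mathcal D(L^{q+1})\to\mathcal H_h$. Consider one of the following two cases, for time steps $k>0$: * (Douglas--Rachford, $r=1$) $S_h=(I-kB_h)^{-1}(I-kA_h)^{-1}(I+k^2A_hB_h)$, and there is a constant $C_3$ with $\|A_hL_h^{-1}\|_h\le C_3$ for all $h\in(0,h_{\max}]$; * (Peaceman--Rachford, $r=2$) $S_h=(I-\tfrac k2B_h)^{-1}(I+\tfrac k2A_h)(I-\tfrac k2A_h)^{-1}(I+\tfrac k2B_h)$, and there is a constant $C_3$ with $\|A_hL_h^{-1}\|_h\le C_3$ and $\|A_h^2L_h^{-2}\|_h\le C_3$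 for all $h\in(0,h_{\max}]$. Then for every $T$ there is a constant $C$ such that for all $h\in(0,h_{\max}]$, all $k>0$, all integers $n\ge 0$ with $nk\le T$, and all $\eta\in\mathcal D(L^{q+r+1})$, $$\|\mathrm e^{nkL}\eta-S_h^nQ_h\eta\|\le C\,(h^s+k^r)\sum_{i=1}^{q+r+1}\|L^i\eta\|.$$ -/

import Mathlib

open Filter Topology
open scoped InnerProductSpace

noncomputable section

namespace SplittingFE

variable {H : Type*} [NormedAddCommGroup H] [InnerProductSpace ℝ H]

/-! ### Unbounded operators and their powers -/

open Classical in
/-- The action of an unbounded operator `E : D(E) ⊂ H → H`, as a function on `H`. It is given the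
value `0` outside `D(E)`; it is only ever used at points of `D(E)`. -/
def act (E : H →ₗ.[ℝ] H) (x : H) : H :=
  if hx : x ∈ E.domain then E ⟨x, hx⟩ else 0

/-- The `i`-th power `E ^ i` of an unbounded operator, as a function; it is used only on
`domPow E m`, `i ≤ m`, where every application of `E` takes place inside `D(E)`. -/
def powAct (E : H →ₗ.[ℝ] H) (i : ℕ) : H → H := (act E)^[i]

/-- The domain `D(E ^ m)`: the points `x` such that `x, E x, …, E ^ (m - 1) x` all lie
in `D(E)`. -/
def domPow (E : H →ₗ.[ℝ] H) (m : ℕ) : Set H :=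
  {x | ∀ i < m, powAct E i x ∈ E.domain}

theorem domPow_zero (E : H →ₗ.[ℝ] H) : domPow E 0 = Set.univ := by
  ext x; simp [domPow]

/-- The recursive description `D(E ^ (m + 1)) = {x ∈ D(E) : E x ∈ D(E ^ m)}`. -/
theorem mem_domPow_succ (E : H →ₗ.[ℝ] H) (m : ℕ) (x : H) :
    x ∈ domPow E (m + 1) ↔ ∃ hx : x ∈ E.domain, E ⟨x, hx⟩ ∈ domPow E m := by
  constructor
  · intro h
    have hx : x ∈ E.domain := h 0 (Nat.succ_pos m)
    refine ⟨hx, fun i hi => ?_⟩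
    have h2 := h (i + 1) (Nat.succ_lt_succ hi)
    simpa [powAct, act, hx] using h2
  · rintro ⟨hx, h⟩ i hi
    cases i with
    | zero => exact hx
    | succ i =>
      have h2 := h i (Nat.lt_of_succ_lt_succ hi)
      simpa [powAct, act, hx] using h2

/-- Maximal dissipative operators: `(E v, v) ≤ 0` on `D(E)` and `R(I - k E) = H` for all
`k > 0`. -/
structure IsMaximalDissipative (E : H →ₗ.[ℝ] H) : Prop where
  dissipative : ∀ v : E.domain, ⟪E v, (v : H)⟫_ℝ ≤ 0
  range_eq : ∀ k : ℝ, 0 < k → ∀ f : H, ∃ v : E.domain, (v : H) - k • E v = f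

/-- Invertibility of an unbounded operator: `E : D(E) → H` is a bijection. -/
def IsInvertible (E : H →ₗ.[ℝ] H) : Prop :=
  Function.Bijective (fun v : E.domain => E v)

/-! ### Strongly continuous semigroups -/

/-- `T` (restricted to times `t ≥ 0`) is a strongly continuous semigroup of bounded operators. -/
structure IsC0Semigroup (T : ℝ → H →L[ℝ] H) : Prop where
  zero : T 0 = ContinuousLinearMap.id ℝ H
  add : ∀ t₁ t₂ : ℝ, 0 ≤ t₁ → 0 ≤ t₂ → T (t₁ + t₂) = (T t₁).comp (T t₂)
  cont : ∀ x : H, ContinuousOn (fun t => T t x) (Set.Ici 0)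

/-- `E` is the infinitesimal generator of the strongly continuous semigroup `T`: `x ∈ D(E)` with
`E x = y` if and only if `(T t x - x) / t → y` as `t ↓ 0`. -/
structure IsGeneratorOf (E : H →ₗ.[ℝ] H) (T : ℝ → H →L[ℝ] H) : Prop where
  semigroup : IsC0Semigroup T
  graph_iff : ∀ x y : H, (x, y) ∈ E.graph ↔
    Tendsto (fun t : ℝ => t⁻¹ • (T t x - x)) (𝓝[>] 0) (𝓝 y)

open Classical in
/-- `expSemigroup E t = e ^ (t E)` for `t ≥ 0`: the strongly continuous semigroup generated
by `E` (and `0` if `E` does not generate one). -/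
def expSemigroup (E : H →ₗ.[ℝ] H) : ℝ → H →L[ℝ] H :=
  if hE : ∃ T : ℝ → H →L[ℝ] H, IsGeneratorOf E T then hE.choose else 0

/-! ### Spatial discretizations -/

variable (H) in
/-- The data of a spatial discretization with mesh parameters `h ∈ (0, hmax]`. -/
structure SpatialDiscretization (hmax : ℝ) where
  /-- The finite dimensional subspace `H_h` of `H`. -/
  space : Set.Ioc (0 : ℝ) hmax → Submodule ℝ H
  finiteDimensional : ∀ h, FiniteDimensional ℝ (space h)
  /-- The inner product of `H_h`, in general different from that of `H`. -/
  ip : ∀ h, InnerProductSpace.Core ℝ (space h)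
  /-- The discrete operator `A_h`. -/
  A : ∀ h, space h →ₗ[ℝ] space h
  /-- The discrete operator `B_h`. -/
  B : ∀ h, space h →ₗ[ℝ] space h
  /-- The mapping `P_h : D(P_h) ⊂ H → H_h`, extended arbitrarily to all of `H`. Only its
  restriction to `D(L ^ q)`, which is contained in `D(P_h)`, is ever used. -/
  P : ∀ h, H → space h

namespace SpatialDiscretization

variable {hmax : ℝ} (D : SpatialDiscretization H hmax) (h : Set.Ioc (0 : ℝ) hmax)

/-- The norm of `H_h` induced by its own inner product. -/
def normh (v : D.space h) : ℝ := √((D.ip h).inner v v)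

/-- The bound `‖E‖_h ≤ C` for the operator norm induced by the norm of `H_h`. -/
def OpNormLE (E : D.space h →ₗ[ℝ] D.space h) (C : ℝ) : Prop :=
  ∀ v, D.normh h (E v) ≤ C * D.normh h v

/-- Dissipativity on `H_h` with respect to its own inner product. -/
def Dissipative (E : D.space h →ₗ[ℝ] D.space h) : Prop :=
  ∀ v, (D.ip h).inner (E v) v ≤ 0

/-- `L_h = A_h + B_h`. -/
def L : D.space h →ₗ[ℝ] D.space h := D.A h + D.B h

/-- `L_h⁻¹`, the inverse in the ring of linear maps `H_h → H_h`. -/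
def Linv : D.space h →ₗ[ℝ] D.space h := Ring.inverse (M₀ := Module.End ℝ (D.space h)) (D.L h)

/-- The assumptions on the spatial discretization, with parameters `s` and `q`, relative to the
operator `E` which is discretized. Here `E⁻¹` is the inverse of the unbounded operator `E`. -/
structure SpaceAssumption (E : H →ₗ.[ℝ] H) (s : ℝ) (q : ℕ) : Prop where
  norm_equiv : ∃ C₁ C₂ : ℝ, 0 < C₁ ∧ 0 < C₂ ∧ ∀ h, ∀ v : D.space h,
    C₁ * ‖(v : H)‖ ≤ D.normh h v ∧ D.normh h v ≤ C₂ * ‖(v : H)‖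
  projection : ∃ C : ℝ, ∀ h, ∀ v ∈ domPow E q,
    ‖(D.P h v : H) - v‖ ≤ C * (h : ℝ) ^ s * ∑ i ∈ Finset.range (q + 1), ‖powAct E i v‖
  dissipative : ∀ h, D.Dissipative h (D.A h) ∧ D.Dissipative h (D.B h)
  invertible : ∀ h, IsUnit (M := Module.End ℝ (D.space h)) (D.L h)
  inverse_bounded : ∃ C : ℝ, ∀ h, D.OpNormLE h (D.Linv h) C
  elliptic_error : ∃ C : ℝ, ∀ h, ∀ v ∈ domPow E q,
    ‖act E.inverse v - (D.Linv h (D.P h v) : H)‖ ≤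
      C * (h : ℝ) ^ s * ∑ i ∈ Finset.range (q + 1), ‖powAct E i v‖

/-- The stability bound for the Douglas–Rachford scheme:
`‖A_h L_h⁻¹‖_h ≤ C` uniformly in `h`. -/
def StabilityDR : Prop :=
  ∃ C : ℝ, ∀ h, D.OpNormLE h (D.A h ∘ₗ D.Linv h) C

/-- The stability bounds for the Peaceman–Rachford scheme:
`‖A_h L_h⁻¹‖_h ≤ C` and `‖A_h² L_h⁻²‖_h ≤ C` uniformly in `h`. -/
def StabilityPR : Prop :=
  ∃ C : ℝ, ∀ h, D.OpNormLE h (D.A h ∘ₗ D.Linv h) C ∧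
    D.OpNormLE h (D.A h ∘ₗ D.A h ∘ₗ D.Linv h ∘ₗ D.Linv h) C

/-- One time step of size `k` of the fully discretized Douglas–Rachford scheme,
`(I - k B_h)⁻¹ (I - k A_h)⁻¹ (I + k² A_h B_h)`. -/
def stepDR (k : ℝ) : Module.End ℝ (D.space h) :=
  let A : Module.End ℝ (D.space h) := D.A h
  let B : Module.End ℝ (D.space h) := D.B h
  Ring.inverse (1 - k • B) * Ring.inverse (1 - k • A) * (1 + k ^ 2 • (A * B))

/-- One time step of size `k` of the fully discretized Peaceman–Rachford scheme,
`(I - k/2 B_h)⁻¹ (I + k/2 A_h) (I - k/2 A_h)⁻¹ (I + k/2 B_h)`. -/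
def stepPR (k : ℝ) : Module.End ℝ (D.space h) :=
  let A : Module.End ℝ (D.space h) := D.A h
  let B : Module.End ℝ (D.space h) := D.B h
  Ring.inverse (1 - (k / 2) • B) * (1 + (k / 2) • A) * Ring.inverse (1 - (k / 2) • A) *
    (1 + (k / 2) • B)

/-- `Q_h = L_h⁻¹ P_h E`, used on `D(E ^ (q + 1))`. -/
def Q (E : H →ₗ.[ℝ] H) (x : H) : D.space h := D.Linv h (D.P h (act E x))

end SpatialDiscretization

end SplittingFE

end

noncomputable section

namespace SplittingFE

/-! ### Generation of contraction semigroups -/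

namespace IsMaximalDissipative

variable {H : Type*} [NormedAddCommGroup H] [InnerProductSpace ℝ H] {E : H →ₗ.[ℝ] H}

/-! Everything is compared with the discrete trajectory `u j = Q e^{jkL} η`, where `Q = L_h⁻¹ Π L`
and `Π` is the orthogonal projection onto `H_h`. The given `P_h` need be neither linear nor bounded.
Best approximation and norm equivalence allow replacing it by `Π` at the cost of an error `O(h^s)`
(`exists_isLinearDiscretization`).

Stability: for dissipative `A` and `B` both schemes are nonexpansive in the norm `‖(I - cB) ·‖_h`,
where `c = k` or `c = k/2`, because Cayley transforms of dissipative operators are contractions.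
This norm dominates `‖·‖_h`, so local errors measured in it simply add up, with no restriction on
`k`.

Consistency: multiplying the local error by `(I - cA)(I - cB)` removes all inverses and leaves `g +
cA f`. Dissipativity of `A` alone then bounds the weighted local error by `‖g‖ + 2‖f‖`, so the
unbounded factor `A` costs nothing. Here `g` contains a quadrature error of the semigroup (implicit
Euler or trapezoidal rule) and the elliptic error of `e^{kL}v - v`, which carries a factor `k`. The
splitting remainder `c² A B Q (e^{kL}v - v)` is controlled through the bounds on `A_h L_h⁻¹` and,
for Peaceman–Rachford, on `A_h² L_h⁻²`.

The sum of `n` local errors, the elliptic error at the final time and the propagated difference of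
the initial values give the theorem. Since the semigroup is selected by choice from those generated
by `L`, its existence is established as well, by Yosida approximation. -/

theorem inner_nonpos (hE : IsMaximalDissipative E) {x y : H} (h : (x, y) ∈ E.graph) :
    ⟪y, x⟫_ℝ ≤ 0 := by
  obtain ⟨v, hv, hv'⟩ := (LinearPMap.mem_graph_iff E).1 h
  simp only at hv hv'
  rw [← hv, ← hv']
  exact hE.dissipative v

theorem norm_le_norm_sub_smul (hE : IsMaximalDissipative E) {k : ℝ} (hk : 0 < k) {x y : H}
    (h : (x, y) ∈ E.graph) : ‖x‖ ≤ ‖x - k • y‖ := by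
  have h1 := hE.inner_nonpos h
  have h2 : ‖x‖ ^ 2 ≤ ‖x - k • y‖ ^ 2 := by
    rw [norm_sub_sq_real, real_inner_smul_right, real_inner_comm]
    nlinarith [sq_nonneg ‖k • y‖, mul_nonneg hk.le (neg_nonneg.2 h1)]
  exact le_of_sq_le_sq h2 (norm_nonneg _)

/-- The range condition gives existence, and `‖v‖ ≤ ‖v - k E v‖` gives both uniqueness and
contractivity. Linearity follows from uniqueness. -/
theorem exists_resolvent (hE : IsMaximalDissipative E) {k : ℝ} (hk : 0 < k) :
    ∃ J : H →L[ℝ] H, (∀ f, ‖J f‖ ≤ ‖f‖) ∧ (∀ f, (J f, k⁻¹ • (J f - f)) ∈ E.graph) ∧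
      ∀ v w, (v, w) ∈ E.graph → J (v - k • w) = v := by
  have hex : ∀ f, ∃ v, (v, k⁻¹ • (v - f)) ∈ E.graph := by
    intro f
    obtain ⟨v, hv⟩ := hE.range_eq k hk f
    refine ⟨v, (LinearPMap.mem_graph_iff E).2 ⟨v, rfl, ?_⟩⟩
    rw [← hv, sub_sub_cancel, smul_smul, inv_mul_cancel₀ hk.ne', one_smul]
  choose J hJ using hex
  have huniq : ∀ v w, (v, w) ∈ E.graph → J (v - k • w) = v := by
    intro v w hvw
    have h1 := E.graph.sub_mem (hJ (v - k • w)) hvw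
    have h2 := hE.norm_le_norm_sub_smul hk h1
    have h3 : (J (v - k • w) - v) - k • (k⁻¹ • (J (v - k • w) - (v - k • w)) - w) = 0 := by
      rw [smul_sub, smul_smul, mul_inv_cancel₀ hk.ne', one_smul]; abel
    simp only at h2
    rw [h3, norm_zero] at h2
    exact sub_eq_zero.1 (norm_le_zero_iff.1 h2)
  have hself : ∀ f, J f - k • (k⁻¹ • (J f - f)) = f := fun f => by
    rw [smul_smul, mul_inv_cancel₀ hk.ne', one_smul]; abel
  let J' : H →ₗ[ℝ] H :=
    { toFun := J
      map_add' := fun f g => by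
        have := huniq _ _ (E.graph.add_mem (hJ f) (hJ g))
        rw [smul_add, add_sub_add_comm, hself, hself] at this
        exact this
      map_smul' := fun c f => by
        have := huniq _ _ (E.graph.smul_mem c (hJ f))
        rw [smul_comm k c, ← smul_sub, hself] at this
        exact this }
  refine ⟨J'.mkContinuous 1 fun f => ?_, fun f => ?_, hJ, huniq⟩
  all_goals
    have := hE.norm_le_norm_sub_smul hk (hJ f)
    rw [hself] at this
    simpa [J'] using this

/-- If `f` is orthogonal to the domain, write `f = v - E v`. Then `0 = (v, f) ≥ ‖v‖²`, so `v = 0`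
and `f = 0`. -/
theorem dense_domain [CompleteSpace H] (hE : IsMaximalDissipative E) :
    Dense (E.domain : Set H) := by
  rw [Submodule.dense_iff_topologicalClosure_eq_top,
    Submodule.topologicalClosure_eq_top_iff, Submodule.eq_bot_iff]
  intro f hf
  obtain ⟨v, hv⟩ := hE.range_eq 1 one_pos f
  have h1 := (Submodule.mem_orthogonal _ _).1 hf v v.2
  have h2 := hE.dissipative v
  rw [← hv, one_smul, inner_sub_right, real_inner_self_eq_norm_sq, real_inner_comm] at h1
  have h3 : (v : H) = 0 := by
    rw [← norm_eq_zero]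
    nlinarith [norm_nonneg (v : H)]
  have h4 : v = 0 := Subtype.ext h3
  rw [← hv, h4]; simp

/-- The Yosida approximation `k⁻¹ ((I - k E)⁻¹ - I)`. -/
theorem exists_yosida (hE : IsMaximalDissipative E) {k : ℝ} (hk : 0 < k) :
    ∃ M : H →L[ℝ] H, (∀ f, ‖f + k • M f‖ ≤ ‖f‖) ∧ (∀ f, (f + k • M f, M f) ∈ E.graph) ∧
      ∀ v w, (v, w) ∈ E.graph → M v = w + k • M w := by
  obtain ⟨J, hJ, hJE, hJu⟩ := hE.exists_resolvent hk
  have e : ∀ f, f + k • (k⁻¹ • (J - ContinuousLinearMap.id ℝ H)) f = J f := fun f => by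
    simp [smul_smul, hk.ne']
  refine ⟨k⁻¹ • (J - ContinuousLinearMap.id ℝ H), fun f => by rw [e]; exact hJ f,
    fun f => by rw [e]; exact hJE f, fun v w hvw => ?_⟩
  rw [e]
  have := hJu v w hvw
  rw [map_sub, map_smul, sub_eq_iff_eq_add, ← sub_eq_iff_eq_add'] at this
  simp [this, smul_smul, hk.ne']

theorem exists_mem_graph_norm_sub_lt [CompleteSpace H] (hE : IsMaximalDissipative E) (x : H)
    {ε : ℝ} (hε : 0 < ε) : ∃ y z, (y, z) ∈ E.graph ∧ ‖x - y‖ < ε := by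
  obtain ⟨y, hy, hxy⟩ := Metric.dense_iff.1 hE.dense_domain x ε hε
  refine ⟨y, E ⟨y, hxy⟩, E.mem_graph ⟨y, hxy⟩, ?_⟩
  rwa [← dist_eq_norm, dist_comm]

end IsMaximalDissipative

/-! ### Semigroups of bounded dissipative operators -/

section Bounded

variable {H : Type*} [NormedAddCommGroup H] [InnerProductSpace ℝ H] [CompleteSpace H]

theorem hasDerivAt_exp_smul_apply (M : H →L[ℝ] H) (x : H) (t : ℝ) :
    HasDerivAt (fun s : ℝ => NormedSpace.exp (s • M) x) (NormedSpace.exp (t • M) (M x)) t :=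
  (hasDerivAt_exp_smul_const (𝕂 := ℝ) M t).clm_apply (hasDerivAt_const t x) |>.congr_deriv (by simp)

theorem norm_exp_smul_apply_le {M : H →L[ℝ] H} (hM : ∀ x, ⟪M x, x⟫_ℝ ≤ 0) {t : ℝ} (ht : 0 ≤ t)
    (x : H) : ‖NormedSpace.exp (t • M) x‖ ≤ ‖x‖ := by
  have hd : ∀ s : ℝ, HasDerivAt (fun s : ℝ => ‖NormedSpace.exp (s • M) x‖ ^ 2)
      (2 * ⟪NormedSpace.exp (s • M) x, NormedSpace.exp (s • M) (M x)⟫_ℝ) s := fun s =>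
    (hasDerivAt_exp_smul_apply M x s).norm_sq
  have hanti : Antitone (fun s : ℝ => ‖NormedSpace.exp (s • M) x‖ ^ 2) := by
    refine antitone_of_deriv_nonpos (fun s => (hd s).differentiableAt) fun s => ?_
    have h : Commute (NormedSpace.exp (s • M)) M := ((Commute.refl M).smul_left s).exp_left
    rw [(hd s).deriv, ← mul_apply_eq_comp, h.eq, mul_apply_eq_comp, real_inner_comm]
    linarith [hM (NormedSpace.exp (s • M) x)]
  have h := hanti ht
  simp only [zero_smul, NormedSpace.exp_zero, one_apply_eq_self] at h
  exact le_of_sq_le_sq h (norm_nonneg _)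

theorem norm_exp_smul_sub_exp_smul_le {M N : H →L[ℝ] H} (hM : ∀ x, ⟪M x, x⟫_ℝ ≤ 0)
    (hN : ∀ x, ⟪N x, x⟫_ℝ ≤ 0) (hMN : Commute M N) {t : ℝ} (ht : 0 ≤ t) (x : H) :
    ‖NormedSpace.exp (t • M) x - NormedSpace.exp (t • N) x‖ ≤ ‖M x - N x‖ * t := by
  -- Interpolate between the two semigroups by `exp(sM) exp((t-s)N) x`. By commutation both
  -- contractions act on `(M - N) x` in the derivative.
  have hd : ∀ s : ℝ, HasDerivAt
      (fun s : ℝ => (NormedSpace.exp (s • M)) ((NormedSpace.exp ((t - s) • N)) x))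
      (NormedSpace.exp (s • M) (NormedSpace.exp ((t - s) • N) (M x - N x))) s := by
    intro s
    have h1 := hasDerivAt_exp_smul_const (𝕂 := ℝ) M s
    have h2 : HasDerivAt (fun s : ℝ => NormedSpace.exp ((t - s) • N) x)
        (-(NormedSpace.exp ((t - s) • N) (N x))) s := by
      exact ((hasDerivAt_exp_smul_apply N x (t - s)).scomp s
        ((hasDerivAt_id s).const_sub t)).congr_deriv (by simp)
    refine (h1.clm_apply h2).congr_deriv ?_
    have h3 : Commute M (NormedSpace.exp ((t - s) • N)) := (hMN.smul_right _).exp_right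
    have h4 := DFunLike.congr_fun h3.eq x
    simp only [mul_apply_eq_comp] at h4 ⊢
    rw [h4, map_sub, map_sub, map_neg, ← sub_eq_add_neg]
  have := norm_image_sub_le_of_norm_deriv_le_segment' (a := 0) (b := t) (C := ‖M x - N x‖)
    (fun s _ => (hd s).hasDerivWithinAt) (fun s hs =>
      (norm_exp_smul_apply_le hM hs.1 _).trans
        (norm_exp_smul_apply_le hN (sub_nonneg.2 hs.2.le) _)) t ⟨ht, le_rfl⟩
  simpa using this

theorem norm_exp_smul_sub_self_le {M : H →L[ℝ] H} (hM : ∀ x, ⟪M x, x⟫_ℝ ≤ 0) {t : ℝ} (ht : 0 ≤ t)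
    (x : H) : ‖NormedSpace.exp (t • M) x - x‖ ≤ ‖M x‖ * t := by
  have := norm_exp_smul_sub_exp_smul_le (N := 0) hM (by simp) (Commute.zero_right M) ht x
  simpa using this

end Bounded

/-! ### Yosida approximation and the generation theorem -/

section Generation

variable {H : Type*} [NormedAddCommGroup H] [InnerProductSpace ℝ H] [CompleteSpace H]
  {E : H →ₗ.[ℝ] H}

/-- The Yosida approximations of a maximal dissipative operator: commuting bounded dissipative
operators, bounded by `E` on its domain and converging to it there. -/
theorem IsMaximalDissipative.exists_seq_yosida (hE : IsMaximalDissipative E) :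
    ∃ M : ℕ → H →L[ℝ] H, (∀ n x, ⟪M n x, x⟫_ℝ ≤ 0) ∧ (∀ m n, Commute (M m) (M n)) ∧
      (∀ n x y, (x, y) ∈ E.graph → ‖M n x‖ ≤ ‖y‖) ∧
      ∀ x y, (x, y) ∈ E.graph → Tendsto (fun n => M n x) atTop (𝓝 y) := by
  set k : ℕ → ℝ := fun n => 1 / ((n : ℝ) + 1) with hkdef
  have hk : ∀ n, 0 < k n := fun n => by positivity
  have hk0 : Tendsto k atTop (𝓝 0) := tendsto_one_div_add_atTop_nhds_zero_nat
  choose M hM1 hM2 hM3 using fun n => hE.exists_yosida (hk n)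
  have hbd : ∀ n x y, (x, y) ∈ E.graph → ‖M n x‖ ≤ ‖y‖ := fun n x y h => by
    rw [hM3 n x y h]; exact hM1 n y
  refine ⟨M, fun n x => ?_, fun m n => ?_, hbd, fun x y h => ?_⟩
  · have h1 := real_inner_le_norm (x + k n • M n x) x
    have h2 := mul_le_mul_of_nonneg_right (hM1 n x) (norm_nonneg x)
    rw [inner_add_left, real_inner_smul_left, real_inner_self_eq_norm_mul_norm] at h1
    have h3 : k n * ⟪M n x, x⟫_ℝ ≤ 0 := by linarith
    exact nonpos_of_mul_nonpos_right h3 (hk n)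
  · rcases eq_or_ne m n with rfl | hmn
    · exact Commute.refl _
    have hkmn : k m - k n ≠ 0 := by
      intro h
      apply hmn
      have h' : ((m : ℝ) + 1) = n + 1 := by
        have := sub_eq_zero.1 h
        simpa [hkdef] using this
      exact_mod_cast add_right_cancel h'
    -- A resolvent identity. Exchanging `m` and `n` and dividing by `k m - k n` yields commutation.
    have key : ∀ m n f, M m f - M n f = (k m - k n) • M m (M n f) := by
      intro m n f
      have e := hM3 m _ (M n f) (hM2 n f)
      rw [map_add, map_smul, add_comm, ← eq_sub_iff_add_eq'] at e
      rw [sub_smul]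
      rw [eq_sub_iff_add_eq, e]
      abel
    ext f
    have h1 := key m n f
    have h2 := key n m f
    rw [← neg_sub (M m f), h1, ← neg_sub (k m), neg_smul, neg_inj] at h2
    exact smul_right_injective H hkmn h2
  · have h1 : ∀ n, ‖M n x - y‖ = ‖k n • M n y‖ := fun n => by
      rw [hM3 n x y h, add_sub_cancel_left]
    rw [tendsto_iff_norm_sub_tendsto_zero]
    simp only [h1]
    rw [Metric.tendsto_atTop]
    intro ε hε
    obtain ⟨u, w, huw, hyu⟩ := hE.exists_mem_graph_norm_sub_lt y (ε := ε / 4) (by positivity)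
    have hlim : Tendsto (fun n => k n * ‖w‖) atTop (𝓝 0) := by simpa using hk0.mul_const ‖w‖
    obtain ⟨N, hN⟩ := (hlim.eventually (gt_mem_nhds (half_pos hε))).exists_forall_of_atTop
    refine ⟨N, fun n hn => ?_⟩
    -- The resolvent is `I + k M`, so `k M (y - u)` is at most `2‖y - u‖`, while `k M u` tends to
    -- zero because `u` lies in the domain.
    have h2 : k n • M n y = k n • M n u + ((y - u + k n • M n (y - u)) - (y - u)) := by
      rw [add_sub_cancel_left, map_sub, smul_sub]; abel
    have h3 : ‖k n • M n u‖ ≤ k n * ‖w‖ := by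
      rw [norm_smul, Real.norm_of_nonneg (hk n).le]
      exact mul_le_mul_of_nonneg_left (hbd n u w huw) (hk n).le
    have h4 := norm_sub_le (y - u + k n • M n (y - u)) (y - u)
    have h5 := hM1 n (y - u)
    have h6 := norm_add_le (k n • M n u) ((y - u + k n • M n (y - u)) - (y - u))
    rw [← h2] at h6
    rw [Real.dist_0_eq_abs, abs_norm]
    linarith [hN n hn]

/-- The limit of the semigroups generated by the Yosida approximations. -/
theorem IsMaximalDissipative.exists_tendsto_exp (hE : IsMaximalDissipative E)
    {M : ℕ → H →L[ℝ] H} (hM : ∀ n x, ⟪M n x, x⟫_ℝ ≤ 0) (hMc : ∀ m n, Commute (M m) (M n))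
    (hMl : ∀ x y, (x, y) ∈ E.graph → Tendsto (fun n => M n x) atTop (𝓝 y)) (t : ℝ) :
    ∃ T : H →L[ℝ] H, 0 ≤ t →
      ∀ x, Tendsto (fun n => NormedSpace.exp (t • M n) x) atTop (𝓝 (T x)) := by
  rcases lt_or_ge t 0 with ht | ht
  · exact ⟨0, fun h => absurd h ht.not_ge⟩
  have hcau : ∀ x, CauchySeq fun n => NormedSpace.exp (t • M n) x := by
    intro x
    rw [Metric.cauchySeq_iff']
    intro ε hε
    obtain ⟨u, w, huw, hxu⟩ := hE.exists_mem_graph_norm_sub_lt x (ε := ε / 4) (by positivity)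
    obtain ⟨N, hN⟩ := Metric.cauchySeq_iff'.1 (hMl u w huw).cauchySeq (ε / (4 * (t + 1)))
      (by positivity)
    refine ⟨N, fun n hn => ?_⟩
    have h1 := norm_exp_smul_sub_exp_smul_le (hM n) (hM N) (hMc n N) ht u
    have h2 : ‖M n u - M N u‖ * t ≤ ε / 4 := by
      have := hN n hn
      rw [dist_eq_norm] at this
      calc ‖M n u - M N u‖ * t ≤ ε / (4 * (t + 1)) * (t + 1) := by
            gcongr; linarith
        _ = ε / 4 := by field_simp
    have h3 := norm_exp_smul_apply_le (hM n) ht (x - u)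
    have h4 := norm_exp_smul_apply_le (hM N) ht (x - u)
    have h5 : NormedSpace.exp (t • M n) x - NormedSpace.exp (t • M N) x =
        NormedSpace.exp (t • M n) (x - u) - NormedSpace.exp (t • M N) (x - u) +
          (NormedSpace.exp (t • M n) u - NormedSpace.exp (t • M N) u) := by
      rw [map_sub, map_sub]; abel
    rw [dist_eq_norm, h5]
    refine (norm_add_le_of_le (norm_sub_le_of_le h3 h4) (h1.trans h2)).trans_lt ?_
    linarith
  choose T hT using fun x => cauchySeq_tendsto_of_complete (hcau x)
  exact ⟨continuousLinearMapOfTendsto (fun n => NormedSpace.exp (t • M n))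
    (tendsto_pi_nhds.2 hT), fun _ x => hT x⟩

/-- A maximal dissipative operator on a Hilbert space generates a strongly continuous
semigroup. -/
theorem IsMaximalDissipative.exists_isGeneratorOf (hE : IsMaximalDissipative E) :
    ∃ T : ℝ → H →L[ℝ] H, IsGeneratorOf E T := by
  obtain ⟨M, hM, hMc, hMb, hMl⟩ := hE.exists_seq_yosida
  choose T hT using hE.exists_tendsto_exp hM hMc hMl
  have hTc : ∀ t, 0 ≤ t → ∀ x, ‖T t x‖ ≤ ‖x‖ := fun t ht x =>
    le_of_tendsto (hT t ht x).norm (Eventually.of_forall fun n => norm_exp_smul_apply_le (hM n) ht x)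
  let _ := NormedAlgebra.restrictScalars ℚ ℝ (H →L[ℝ] H)
  have hadd : ∀ t₁ t₂ : ℝ, 0 ≤ t₁ → 0 ≤ t₂ → T (t₁ + t₂) = (T t₁).comp (T t₂) := by
    intro t₁ t₂ h₁ h₂
    ext x
    refine tendsto_nhds_unique (hT _ (add_nonneg h₁ h₂) x) ?_
    have e : ∀ n, NormedSpace.exp ((t₁ + t₂) • M n) x =
        NormedSpace.exp (t₁ • M n) (NormedSpace.exp (t₂ • M n) x - T t₂ x) +
          NormedSpace.exp (t₁ • M n) (T t₂ x) := fun n => by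
      rw [← map_add, sub_add_cancel, add_smul, NormedSpace.exp_add_of_commute
        (((Commute.refl (M n)).smul_left t₁).smul_right t₂), mul_apply_eq_comp]
    simp only [e]
    rw [← zero_add (((T t₁).comp (T t₂)) x)]
    refine Tendsto.add ?_ (hT t₁ h₁ _)
    refine squeeze_zero_norm (fun n => norm_exp_smul_apply_le (hM n) h₁ _) ?_
    exact tendsto_iff_norm_sub_tendsto_zero.1 (hT t₂ h₂ x)
  have hT0 : ∀ x, T 0 x = x := fun x => by
    refine tendsto_nhds_unique (hT 0 le_rfl x) ?_
    simp [NormedSpace.exp_zero]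
  have hlip : ∀ x y, (x, y) ∈ E.graph → ∀ t, 0 ≤ t → ‖T t x - x‖ ≤ ‖y‖ * t := by
    intro x y hxy t ht
    refine le_of_tendsto ((hT t ht x).sub_const x).norm (Eventually.of_forall fun n => ?_)
    exact (norm_exp_smul_sub_self_le (hM n) ht x).trans
      (mul_le_mul_of_nonneg_right (hMb n x y hxy) ht)
  have hlip' : ∀ x y, (x, y) ∈ E.graph → ∀ s t, 0 ≤ s → s ≤ t → ‖T t x - T s x‖ ≤ ‖y‖ * (t - s) := by
    intro x y hxy s t hs hst
    have h1 := hadd s (t - s) hs (sub_nonneg.2 hst)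
    rw [add_sub_cancel] at h1
    rw [h1, ContinuousLinearMap.comp_apply, ← map_sub]
    exact (hTc s hs _).trans (hlip x y hxy _ (sub_nonneg.2 hst))
  have hcont : ∀ x, ContinuousOn (fun t => T t x) (Set.Ici 0) := by
    intro x
    refine continuousOn_of_uniform_approx_of_continuousOn fun u hu => ?_
    obtain ⟨ε, hε, hεu⟩ := Metric.mem_uniformity_dist.1 hu
    obtain ⟨y, z, hyz, hxy⟩ := hE.exists_mem_graph_norm_sub_lt x hε
    refine ⟨fun t => T t y, ?_, fun t ht => hεu ?_⟩
    · refine LipschitzOnWith.continuousOn (K := ‖z‖₊) (LipschitzOnWith.of_dist_le_mul ?_)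
      have : ∀ s t : ℝ, 0 ≤ s → s ≤ t → dist (T s y) (T t y) ≤ ‖z‖₊ * dist s t := by
        intro s t hs hst
        rw [dist_comm, dist_eq_norm, dist_comm, Real.dist_eq, abs_of_nonneg (sub_nonneg.2 hst)]
        exact hlip' y z hyz s t hs hst
      intro s hs t ht
      rcases le_total s t with h | h
      · exact this s t hs h
      · rw [dist_comm, dist_comm s]; exact this t s ht h
    · rw [dist_eq_norm, ← map_sub]
      exact (hTc t ht _).trans_lt hxy
  have hderiv : ∀ x y, (x, y) ∈ E.graph →
      Tendsto (fun t : ℝ => t⁻¹ • (T t x - x)) (𝓝[>] 0) (𝓝 y) := by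
    intro x y hxy
    -- `y = E x` need not lie in the domain, so it is approximated by a domain element `z`, for
    -- which `exp(sM) z - z` is `O(s)` uniformly in `n`.
    have hbound : ∀ z w, (z, w) ∈ E.graph → ∀ t, 0 ≤ t →
        ‖T t x - x - t • y‖ ≤ (2 * ‖y - z‖ + ‖w‖ * t) * t := by
      intro z w hzw t ht
      have hl : Tendsto (fun n => (‖M n x - y‖ + (2 * ‖y - z‖ + ‖w‖ * t)) * t) atTop
          (𝓝 ((0 + (2 * ‖y - z‖ + ‖w‖ * t)) * t)) :=
        ((tendsto_iff_norm_sub_tendsto_zero.1 (hMl x y hxy)).add_const _).mul_const _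
      rw [zero_add] at hl
      refine le_of_tendsto_of_tendsto (((hT t ht x).sub_const x).sub_const (t • y)).norm hl
        (Eventually.of_forall fun n => ?_)
      have hd : ∀ s : ℝ, HasDerivAt (fun s : ℝ => NormedSpace.exp (s • M n) x - s • y)
          (NormedSpace.exp (s • M n) (M n x) - y) s := fun s =>
        ((hasDerivAt_exp_smul_apply (M n) x s).sub ((hasDerivAt_id s).smul_const y)).congr_deriv
          (by simp)
      have := norm_image_sub_le_of_norm_deriv_le_segment' (a := 0) (b := t)
        (C := ‖M n x - y‖ + (2 * ‖y - z‖ + ‖w‖ * t))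
        (fun s _ => (hd s).hasDerivWithinAt) (fun s hs => ?_) t ⟨ht, le_rfl⟩
      · simpa [sub_right_comm, NormedSpace.exp_zero] using this
      · have e : NormedSpace.exp (s • M n) (M n x) - y =
            NormedSpace.exp (s • M n) (M n x - y) + (NormedSpace.exp (s • M n) (y - z) - (y - z) +
              (NormedSpace.exp (s • M n) z - z)) := by
          simp only [map_sub]; abel
        rw [e]
        refine norm_add_le_of_le (norm_exp_smul_apply_le (hM n) hs.1 _) (norm_add_le_of_le ?_ ?_)
        · rw [two_mul]
          exact norm_sub_le_of_le (norm_exp_smul_apply_le (hM n) hs.1 _) le_rfl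
        · refine (norm_exp_smul_sub_self_le (hM n) hs.1 z).trans ?_
          exact mul_le_mul (hMb n z w hzw) hs.2.le hs.1 (norm_nonneg _)
    rw [Metric.tendsto_nhdsWithin_nhds]
    intro ε hε
    obtain ⟨z, w, hzw, hyz⟩ := hE.exists_mem_graph_norm_sub_lt y (ε := ε / 4) (by positivity)
    refine ⟨ε / (2 * (‖w‖ + 1)), by positivity, fun t ht htd => ?_⟩
    have ht0 : (0 : ℝ) < t := ht
    rw [Real.dist_0_eq_abs, abs_of_pos ht0, lt_div_iff₀ (by positivity)] at htd
    have e : t⁻¹ • (T t x - x) - y = t⁻¹ • (T t x - x - t • y) := by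
      rw [smul_sub t⁻¹ (T t x - x), smul_smul, inv_mul_cancel₀ ht0.ne', one_smul]
    rw [dist_eq_norm, e, norm_smul, norm_inv, Real.norm_of_nonneg ht0.le, inv_mul_lt_iff₀ ht0]
    refine (hbound z w hzw t ht0.le).trans_lt ?_
    rw [mul_comm]
    refine mul_lt_mul_of_pos_left ?_ ht0
    nlinarith [norm_nonneg w]
  refine ⟨T, ⟨ContinuousLinearMap.ext hT0, hadd, hcont⟩, fun x y => ⟨hderiv x y, fun h => ?_⟩⟩
  -- Maximality: the generator of a contraction semigroup is dissipative and extends `E`. Since `I -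
  -- E` is already onto, the extension cannot be proper.
  obtain ⟨u, hu⟩ := hE.range_eq 1 one_pos (x - y)
  have hug := E.mem_graph u
  have h1 := h.sub (hderiv _ _ hug)
  have e : y - E u = x - u := by
    rw [one_smul] at hu
    have : x - y - (u - E u) = 0 := by rw [hu, sub_self]
    have h3 : y - E u = x - u - (x - y - (u - E u)) := by abel
    rw [h3, this, sub_zero]
  have h2 : ⟪y - E u, x - u⟫_ℝ ≤ 0 := by
    refine le_of_tendsto (h1.inner tendsto_const_nhds) ?_
    filter_upwards [self_mem_nhdsWithin] with t ht
    have ht0 : (0 : ℝ) < t := ht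
    rw [← smul_sub, sub_sub_sub_comm, ← map_sub, real_inner_smul_left]
    refine mul_nonpos_of_nonneg_of_nonpos (inv_nonneg.2 ht0.le) ?_
    rw [inner_sub_left, real_inner_self_eq_norm_mul_norm]
    have := real_inner_le_norm (T t (x - u)) (x - u)
    have := mul_le_mul_of_nonneg_right (hTc t ht0.le (x - u)) (norm_nonneg (x - u))
    linarith
  rw [e, real_inner_self_nonpos, sub_eq_zero] at h2
  rw [h2, sub_self, sub_eq_zero] at e
  rw [h2, e]
  exact hug

end Generation

/-! ### Calculus of powers of an unbounded operator -/

section Powers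

variable {H : Type*} [NormedAddCommGroup H] [InnerProductSpace ℝ H] {E : H →ₗ.[ℝ] H}

theorem act_eq_of_mem_graph {x y : H} (h : (x, y) ∈ E.graph) : act E x = y := by
  obtain ⟨v, hv, hv'⟩ := (LinearPMap.mem_graph_iff E).1 h
  simp only at hv hv'
  subst hv hv'
  simp [act]

theorem mem_graph_act {x : H} (h : x ∈ E.domain) : (x, act E x) ∈ E.graph := by
  rw [act, dif_pos h]; exact E.mem_graph ⟨x, h⟩

theorem powAct_succ (E : H →ₗ.[ℝ] H) (i : ℕ) (x : H) :
    powAct E (i + 1) x = act E (powAct E i x) :=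
  Function.iterate_succ_apply' _ _ _

theorem mem_graph_powAct {m i : ℕ} {x : H} (hx : x ∈ domPow E m) (hi : i < m) :
    (powAct E i x, powAct E (i + 1) x) ∈ E.graph := by
  rw [powAct_succ]; exact mem_graph_act (hx i hi)

theorem act_mem_domPow {m : ℕ} {x : H} (hx : x ∈ domPow E (m + 1)) : act E x ∈ domPow E m :=
  fun i hi => hx (i + 1) (Nat.succ_lt_succ hi)

theorem domPow_anti {m n : ℕ} (hmn : m ≤ n) : domPow E n ⊆ domPow E m :=
  fun _ hx i hi => hx i (hi.trans_le hmn)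

/-- A chain of graph points certifies the values of all powers, so the default value of `act` never
enters. It is applied to differences and to images under the semigroup. -/
theorem powAct_eq_of_mem_graph {m : ℕ} {w : ℕ → H}
    (hw : ∀ i < m, (w i, w (i + 1)) ∈ E.graph) {i : ℕ} (hi : i ≤ m) : powAct E i (w 0) = w i := by
  induction i with
  | zero => rfl
  | succ i ih =>
    rw [powAct_succ, ih (Nat.le_of_succ_le hi), act_eq_of_mem_graph (hw i hi)]

theorem mem_domPow_of_mem_graph {m : ℕ} {w : ℕ → H}
    (hw : ∀ i < m, (w i, w (i + 1)) ∈ E.graph) : w 0 ∈ domPow E m := fun i hi => by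
  rw [powAct_eq_of_mem_graph hw hi.le]
  exact LinearPMap.mem_domain_of_mem_graph (hw i hi)

theorem sub_mem_domPow {m : ℕ} {x y : H} (hx : x ∈ domPow E m) (hy : y ∈ domPow E m) :
    x - y ∈ domPow E m :=
  mem_domPow_of_mem_graph (w := fun i => powAct E i x - powAct E i y)
    fun _ hi => E.graph.sub_mem (mem_graph_powAct hx hi) (mem_graph_powAct hy hi)

theorem powAct_sub {m i : ℕ} {x y : H} (hx : x ∈ domPow E m) (hy : y ∈ domPow E m) (hi : i ≤ m) :
    powAct E i (x - y) = powAct E i x - powAct E i y :=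
  powAct_eq_of_mem_graph (w := fun i => powAct E i x - powAct E i y)
    (fun _ hi => E.graph.sub_mem (mem_graph_powAct hx hi) (mem_graph_powAct hy hi)) hi

theorem IsInvertible.act_inverse (hE : IsInvertible E) {x y : H} (h : (x, y) ∈ E.graph) :
    act E.inverse y = x := by
  refine act_eq_of_mem_graph ?_
  obtain ⟨v, hv, hv'⟩ := (LinearPMap.mem_graph_iff E).1 h
  simp only at hv hv'
  subst hv hv'
  exact LinearPMap.mem_inverse_graph (LinearMap.ker_eq_bot.2 hE.1) v

end Powers

/-! ### Orbits of the semigroup: contractivity and quadrature errors -/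

namespace IsGeneratorOf

variable {H : Type*} [NormedAddCommGroup H] [InnerProductSpace ℝ H] {E : H →ₗ.[ℝ] H}
  {T : ℝ → H →L[ℝ] H}

theorem comm_apply (hT : IsGeneratorOf E T) {s t : ℝ} (hs : 0 ≤ s) (ht : 0 ≤ t) (x : H) :
    T s (T t x) = T t (T s x) := by
  have h := hT.semigroup.add s t hs ht
  rw [add_comm, hT.semigroup.add t s ht hs] at h
  exact (DFunLike.congr_fun h x).symm

theorem apply_zero (hT : IsGeneratorOf E T) (x : H) : T 0 x = x := by
  rw [hT.semigroup.zero]; rfl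

theorem apply_mem_graph (hT : IsGeneratorOf E T) {x y : H} (h : (x, y) ∈ E.graph) {t : ℝ}
    (ht : 0 ≤ t) : (T t x, T t y) ∈ E.graph := by
  refine (hT.graph_iff _ _).2 ((((T t).continuous.tendsto _).comp
    ((hT.graph_iff _ _).1 h)).congr' ?_)
  filter_upwards [self_mem_nhdsWithin] with s hs
  rw [Function.comp_apply, map_smul, map_sub, hT.comm_apply ht (le_of_lt hs)]

/-- The definition of the generator directly gives only right derivatives. Together with continuity
they suffice for the mean value inequalities below. -/
theorem hasDerivWithinAt_apply (hT : IsGeneratorOf E T) {x y : H} (h : (x, y) ∈ E.graph) {t : ℝ}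
    (ht : 0 ≤ t) : HasDerivWithinAt (fun s => T s x) (T t y) (Set.Ici t) t := by
  rw [← hasDerivWithinAt_Ioi_iff_Ici, hasDerivWithinAt_iff_tendsto_slope' Set.self_notMem_Ioi]
  have h1 := (hT.graph_iff _ _).1 (hT.apply_mem_graph h ht)
  have h2 : Tendsto (fun s => s - t) (𝓝[>] t) (𝓝[>] 0) := by
    refine tendsto_nhdsWithin_iff.2 ⟨?_, ?_⟩
    · have : Tendsto (fun s => s - t) (𝓝 t) (𝓝 (t - t)) := tendsto_id.sub_const t
      rw [sub_self] at this
      exact this.mono_left nhdsWithin_le_nhds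
    · filter_upwards [self_mem_nhdsWithin] with s hs
      exact sub_pos.2 (Set.mem_Ioi.1 hs)
  refine (h1.comp h2).congr' ?_
  filter_upwards [self_mem_nhdsWithin] with s hs
  have h3 := hT.semigroup.add (s - t) t (sub_nonneg.2 (le_of_lt hs)) ht
  rw [sub_add_cancel] at h3
  rw [Function.comp_apply, slope_def_module, h3]
  rfl

theorem continuousOn_apply (hT : IsGeneratorOf E T) (x : H) (t : ℝ) :
    ContinuousOn (fun s => T s x) (Set.Icc 0 t) :=
  (hT.semigroup.cont x).mono Set.Icc_subset_Ici_self

/-- On the domain the right derivative of `‖T s x‖²` is `2 (T s x, E T s x) ≤ 0`; density does the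
rest. The argument applies to any semigroup generated by `E`. -/
theorem norm_apply_le [CompleteSpace H] (hT : IsGeneratorOf E T) (hE : IsMaximalDissipative E)
    {t : ℝ} (ht : 0 ≤ t) (x : H) : ‖T t x‖ ≤ ‖x‖ := by
  have key : ∀ x y, (x, y) ∈ E.graph → ‖T t x‖ ≤ ‖x‖ := by
    intro x y h
    have h1 := image_le_of_deriv_right_le_deriv_boundary (a := 0) (b := t)
      (f := fun s => ‖T s x‖ ^ 2) (f' := fun s => 2 * ⟪T s x, T s y⟫_ℝ)
      (B := fun _ => ‖x‖ ^ 2) (B' := fun _ => 0)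
      ((hT.continuousOn_apply x t).norm.pow 2)
      (fun s hs => (hT.hasDerivWithinAt_apply h hs.1).norm_sq)
      (by rw [hT.apply_zero]) continuousOn_const
      (fun s _ => hasDerivWithinAt_const _ _ _)
      (fun s hs => by
        have := hE.inner_nonpos (hT.apply_mem_graph h hs.1)
        rw [real_inner_comm] at this
        linarith) ⟨ht, le_rfl⟩
    exact le_of_sq_le_sq h1 (norm_nonneg _)
  refine hE.dense_domain.induction (P := fun x => ‖T t x‖ ≤ ‖x‖)
    (fun x hx => key x _ (E.mem_graph ⟨x, hx⟩)) ?_ x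
  exact isClosed_le (T t).continuous.norm continuous_norm

theorem norm_apply_sub_le [CompleteSpace H] (hT : IsGeneratorOf E T) (hE : IsMaximalDissipative E)
    {t : ℝ} (ht : 0 ≤ t) {x y : H} (h : (x, y) ∈ E.graph) : ‖T t x - x‖ ≤ ‖y‖ * t := by
  have := norm_image_sub_le_of_norm_deriv_right_le_segment (hT.continuousOn_apply x t)
    (fun s hs => hT.hasDerivWithinAt_apply h hs.1)
    (fun s hs => hT.norm_apply_le hE hs.1 y) t ⟨ht, le_rfl⟩
  simpa [hT.apply_zero] using this

/-- The consistency of the implicit Euler scheme. -/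
theorem norm_apply_sub_sub_smul_le [CompleteSpace H] (hT : IsGeneratorOf E T)
    (hE : IsMaximalDissipative E) {t : ℝ} (ht : 0 ≤ t) {x y z : H} (hxy : (x, y) ∈ E.graph)
    (hyz : (y, z) ∈ E.graph) : ‖T t x - x - t • T t y‖ ≤ ‖z‖ * t ^ 2 := by
  have := norm_image_sub_le_of_norm_deriv_right_le_segment (a := 0) (b := t)
    (f := fun s => T s x - s • T s y) (f' := fun s => -(s • T s z)) (C := ‖z‖ * t)
    ((hT.continuousOn_apply x t).sub (continuousOn_id.smul (hT.continuousOn_apply y t)))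
    (fun s hs => ((hT.hasDerivWithinAt_apply hxy hs.1).sub
      ((hasDerivWithinAt_id s _).smul (hT.hasDerivWithinAt_apply hyz hs.1))).congr_deriv
        (by simp)) (fun s hs => ?_) t ⟨ht, le_rfl⟩
  · simp only [hT.apply_zero, zero_smul, sub_zero] at this
    rw [sub_right_comm]
    exact this.trans_eq (by ring)
  · rw [norm_neg, norm_smul, Real.norm_of_nonneg hs.1, mul_comm]
    exact mul_le_mul (hT.norm_apply_le hE hs.1 z) hs.2.le hs.1 (norm_nonneg _)

/-- The consistency of the trapezoidal rule. -/
theorem norm_apply_sub_sub_smul_add_le [CompleteSpace H] (hT : IsGeneratorOf E T)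
    (hE : IsMaximalDissipative E) {t : ℝ} (ht : 0 ≤ t) {x y z w : H} (hxy : (x, y) ∈ E.graph)
    (hyz : (y, z) ∈ E.graph) (hzw : (z, w) ∈ E.graph) :
    ‖T t x - x - (t / 2) • (T t y + y)‖ ≤ ‖w‖ * t ^ 3 := by
  -- The derivative of this defect is half the implicit Euler defect of `y`, which is of second
  -- order.
  have := norm_image_sub_le_of_norm_deriv_right_le_segment (a := 0) (b := t)
    (f := fun s => T s x - (s / 2) • (T s y + y))
    (f' := fun s => (1 / 2 : ℝ) • (T s y - y - s • T s z)) (C := ‖w‖ * t ^ 2)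
    ((hT.continuousOn_apply x t).sub ((continuousOn_id.div_const 2).smul
      ((hT.continuousOn_apply y t).add continuousOn_const)))
    (fun s hs => ((hT.hasDerivWithinAt_apply hxy hs.1).sub
      (((hasDerivWithinAt_id s _).div_const 2).smul
        ((hT.hasDerivWithinAt_apply hyz hs.1).add_const y))).congr_deriv
        (by simp only [id]; module)) (fun s hs => ?_) t ⟨ht, le_rfl⟩
  · simp only [hT.apply_zero, zero_div, zero_smul, sub_zero] at this
    rw [sub_right_comm]
    exact this.trans_eq (by ring)
  · have h1 := hT.norm_apply_sub_sub_smul_le hE hs.1 hyz hzw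
    have h2 : ‖w‖ * s ^ 2 ≤ ‖w‖ * t ^ 2 :=
      mul_le_mul_of_nonneg_left (pow_le_pow_left₀ hs.1 hs.2.le 2) (norm_nonneg _)
    rw [norm_smul, Real.norm_of_nonneg (by norm_num)]
    linarith [norm_nonneg (T s y - y - s • T s z)]

theorem apply_mem_domPow (hT : IsGeneratorOf E T) {m : ℕ} {x : H} (hx : x ∈ domPow E m) {t : ℝ}
    (ht : 0 ≤ t) : T t x ∈ domPow E m :=
  mem_domPow_of_mem_graph (w := fun i => T t (powAct E i x))
    fun _ hi => hT.apply_mem_graph (mem_graph_powAct hx hi) ht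

theorem powAct_apply (hT : IsGeneratorOf E T) {m i : ℕ} {x : H} (hx : x ∈ domPow E m) (hi : i ≤ m)
    {t : ℝ} (ht : 0 ≤ t) : powAct E i (T t x) = T t (powAct E i x) :=
  powAct_eq_of_mem_graph (w := fun i => T t (powAct E i x))
    (fun _ hi => hT.apply_mem_graph (mem_graph_powAct hx hi) ht) hi

end IsGeneratorOf

/-! ### Splitting schemes on a finite dimensional inner product space -/

section Splitting

variable {V : Type*} [NormedAddCommGroup V] [InnerProductSpace ℝ V] {A B S : Module.End ℝ V}
  {c : ℝ}

theorem norm_le_norm_sub_smul_apply (hA : ∀ v, ⟪A v, v⟫_ℝ ≤ 0) (hc : 0 ≤ c) (x : V) :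
    ‖x‖ ≤ ‖x - c • A x‖ := by
  refine le_of_sq_le_sq ?_ (norm_nonneg _)
  rw [norm_sub_sq_real, real_inner_smul_right, real_inner_comm]
  nlinarith [sq_nonneg ‖c • A x‖, mul_nonneg hc (neg_nonneg.2 (hA x))]

/-- The Cayley transform of a dissipative operator is a contraction. -/
theorem norm_le_of_sub_smul_eq_add_smul (hA : ∀ v, ⟪A v, v⟫_ℝ ≤ 0) (hc : 0 ≤ c) {x y : V}
    (h : x - c • A x = y + c • A y) : ‖x‖ ≤ ‖y‖ := by
  have h1 : x - y = c • A (x + y) := by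
    rw [map_add, smul_add, ← sub_eq_zero, ← sub_eq_zero.2 h]
    abel
  have h2 : ⟪x - y, x + y⟫_ℝ ≤ 0 := by
    rw [h1, real_inner_smul_left]
    exact mul_nonpos_of_nonneg_of_nonpos hc (hA _)
  rw [inner_add_right, inner_sub_left, inner_sub_left, real_inner_comm y x,
    real_inner_self_eq_norm_sq, real_inner_self_eq_norm_sq] at h2
  exact le_of_sq_le_sq (by linarith) (norm_nonneg _)

/-- Since `(I - cA)(x + f) = g + f`, dissipativity bounds `x + f`. A term `cA f` thus costs only
`2‖f‖`, whatever the size of `A`. -/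
theorem norm_le_of_sub_smul_eq (hA : ∀ v, ⟪A v, v⟫_ℝ ≤ 0) (hc : 0 ≤ c) {x g f : V}
    (h : x - c • A x = g + c • A f) : ‖x‖ ≤ ‖g‖ + 2 * ‖f‖ := by
  have h1 := norm_le_norm_sub_smul_apply hA hc (x + f)
  have h2 : x + f - c • A (x + f) = g + f := by
    rw [map_add, smul_add, add_sub_add_comm, h]; abel
  rw [h2] at h1
  have h3 := norm_sub_le (x + f) f
  rw [add_sub_cancel_right] at h3
  linarith [norm_add_le g f]

/-- The lower bound gives injectivity, which suffices in finite dimension. Hence `Ring.inverse` is a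
true inverse in the schemes and not its default value `0`. -/
theorem isUnit_one_sub_smul [FiniteDimensional ℝ V] (hA : ∀ v, ⟪A v, v⟫_ℝ ≤ 0) (hc : 0 ≤ c) :
    IsUnit (1 - c • A) := by
  rw [LinearMap.isUnit_iff_ker_eq_bot, LinearMap.ker_eq_bot']
  intro x hx
  have h := norm_le_norm_sub_smul_apply hA hc x
  have hx' : x - c • A x = 0 := hx
  rwa [hx', norm_zero, norm_le_zero_iff] at h

theorem sub_smul_apply_stepDR [FiniteDimensional ℝ V] (hA : ∀ v, ⟪A v, v⟫_ℝ ≤ 0)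
    (hB : ∀ v, ⟪B v, v⟫_ℝ ≤ 0) (hc : 0 ≤ c)
    (hS : S = Ring.inverse (1 - c • B) * Ring.inverse (1 - c • A) * (1 + c ^ 2 • (A * B))) (x : V) :
    (S x - c • B (S x)) - c • A (S x - c • B (S x)) = x + c ^ 2 • A (B x) := by
  have h : (1 - c • A) * ((1 - c • B) * S) = 1 + c ^ 2 • (A * B) := by
    rw [hS, mul_assoc, Ring.mul_inverse_cancel_left _ _ (isUnit_one_sub_smul hB hc),
      Ring.mul_inverse_cancel_left _ _ (isUnit_one_sub_smul hA hc)]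
  exact DFunLike.congr_fun h x

theorem sub_smul_apply_stepPR [FiniteDimensional ℝ V] (hA : ∀ v, ⟪A v, v⟫_ℝ ≤ 0)
    (hB : ∀ v, ⟪B v, v⟫_ℝ ≤ 0) (hc : 0 ≤ c)
    (hS : S = Ring.inverse (1 - c • B) * (1 + c • A) * Ring.inverse (1 - c • A) * (1 + c • B))
    (x : V) :
    (S x - c • B (S x)) - c • A (S x - c • B (S x)) = (x + c • B x) + c • A (x + c • B x) := by
  have hcomm : (1 - c • A) * (1 + c • A) = (1 + c • A) * (1 - c • A) := by
    simp only [mul_add, add_mul, mul_sub, sub_mul, mul_one, one_mul]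
    abel
  have h : (1 - c • A) * ((1 - c • B) * S) = (1 + c • A) * (1 + c • B) := by
    rw [hS, mul_assoc, mul_assoc, Ring.mul_inverse_cancel_left _ _ (isUnit_one_sub_smul hB hc),
      ← mul_assoc, hcomm, mul_assoc,
      Ring.mul_inverse_cancel_left _ _ (isUnit_one_sub_smul hA hc)]
  exact DFunLike.congr_fun h x

/-- The Peaceman–Rachford scheme is stable in the norm `‖(I - c B) ·‖`. -/
theorem norm_stepPR_le (hA : ∀ v, ⟪A v, v⟫_ℝ ≤ 0) (hB : ∀ v, ⟪B v, v⟫_ℝ ≤ 0) (hc : 0 ≤ c) {x y : V}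
    (h : (y - c • B y) - c • A (y - c • B y) = (x + c • B x) + c • A (x + c • B x)) :
    ‖y - c • B y‖ ≤ ‖x - c • B x‖ := by
  refine (norm_le_of_sub_smul_eq_add_smul hA hc h).trans ?_
  refine norm_le_of_sub_smul_eq_add_smul hB hc ?_
  simp only [map_add, map_sub, map_smul]
  module

/-- The Douglas–Rachford scheme is stable in the norm `‖(I - c B) ·‖`. -/
theorem norm_stepDR_le (hA : ∀ v, ⟪A v, v⟫_ℝ ≤ 0) (hB : ∀ v, ⟪B v, v⟫_ℝ ≤ 0) (hc : 0 ≤ c) {x y : V}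
    (h : (y - c • B y) - c • A (y - c • B y) = x + c ^ 2 • A (B x)) :
    ‖y - c • B y‖ ≤ ‖x - c • B x‖ := by
  set z := y - c • B y
  set p := x - c • B x with hp
  -- Here `(I - cA)(2z - p) = (I + cA)(x + cBx)` and `(I - cB)(x + cBx) = (I + cB)p`. So `z` is the
  -- average of `p` and the image of `p` under two Cayley transforms.
  have h1 : ‖(2 : ℝ) • z - p‖ ≤ ‖x + c • B x‖ := by
    refine norm_le_of_sub_smul_eq_add_smul hA hc ?_
    have e : (2 : ℝ) • z - p - c • A ((2 : ℝ) • z - p) = (2 : ℝ) • (z - c • A z) - (p - c • A p) := by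
      simp only [map_sub, map_smul]; module
    rw [e, h, hp]
    simp only [map_sub, map_add, map_smul]; module
  have h2 : ‖x + c • B x‖ ≤ ‖p‖ := by
    refine norm_le_of_sub_smul_eq_add_smul hB hc ?_
    rw [hp]
    simp only [map_add, map_sub, map_smul]; module
  have h3 := norm_add_le ((2 : ℝ) • z - p) p
  rw [sub_add_cancel, norm_smul, Real.norm_ofNat] at h3
  linarith

theorem norm_pow_apply_le (hB : ∀ v, ⟪B v, v⟫_ℝ ≤ 0) (hc : 0 ≤ c)
    (hS : ∀ x, ‖S x - c • B (S x)‖ ≤ ‖x - c • B x‖) (n : ℕ) (x : V) :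
    ‖(S ^ n) x‖ ≤ ‖x‖ + n * c * ‖B x‖ := by
  have h : ∀ n : ℕ, ‖(S ^ n) x - c • B ((S ^ n) x)‖ ≤ ‖x - c • B x‖ := by
    intro n
    induction n with
    | zero => exact le_rfl
    | succ n ih =>
      rw [pow_succ']
      exact (hS _).trans ih
  -- One factor `c‖Bx‖` arises from the weighted norm of `x`. It is weakened to `n c‖Bx‖` because
  -- only `n c`, not `c`, is bounded by the final time; for `n = 0` it is absent.
  rcases n.eq_zero_or_pos with rfl | hn
  · simp
  · refine (norm_le_norm_sub_smul_apply hB hc _).trans ((h n).trans ?_)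
    refine (norm_sub_le _ _).trans ?_
    rw [norm_smul, Real.norm_of_nonneg hc]
    have hn' : (1 : ℝ) ≤ n := by exact_mod_cast hn
    gcongr
    nlinarith

/-- The errors telescope in the norm `‖(I - cB) ·‖`, where `S` is nonexpansive; this norm is left
only at the end. -/
theorem norm_sub_pow_apply_le (hB : ∀ v, ⟪B v, v⟫_ℝ ≤ 0) (hc : 0 ≤ c)
    (hS : ∀ x, ‖S x - c • B (S x)‖ ≤ ‖x - c • B x‖) {u : ℕ → V} {δ : ℝ}
    (hu : ∀ j, ‖(u (j + 1) - S (u j)) - c • B (u (j + 1) - S (u j))‖ ≤ δ) (n : ℕ) :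
    ‖u n - (S ^ n) (u 0)‖ ≤ n * δ := by
  suffices h : ‖(u n - (S ^ n) (u 0)) - c • B (u n - (S ^ n) (u 0))‖ ≤ n * δ from
    (norm_le_norm_sub_smul_apply hB hc _).trans h
  induction n with
  | zero => simp
  | succ n ih =>
    have e : u (n + 1) - (S ^ (n + 1)) (u 0) =
        (u (n + 1) - S (u n)) + S (u n - (S ^ n) (u 0)) := by
      rw [pow_succ', map_sub, Module.End.mul_apply]; abel
    have e2 : ∀ a b : V, a + b - c • B (a + b) = (a - c • B a) + (b - c • B b) := fun a b => by
      rw [map_add]; module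
    rw [e, e2]
    refine (norm_add_le_of_le (hu n) ((hS _).trans ih)).trans_eq ?_
    push_cast; ring

end Splitting

/-! ### Error bounds for a linear discretization -/

section LinearDiscretization

variable {H : Type*} [NormedAddCommGroup H] [InnerProductSpace ℝ H]
  {V : Type*} [NormedAddCommGroup V] [InnerProductSpace ℝ V]

/-- A splitting `A + B` with right inverse `G`, and a linear projection `P`, which approximate
`E` with accuracy `ε`. -/
structure IsLinearDiscretization (E : H →ₗ.[ℝ] H) (q : ℕ) (A B G : Module.End ℝ V) (P : H →ₗ[ℝ] V)
    (K ε : ℝ) : Prop where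
  nonneg : 0 ≤ K
  eps_nonneg : 0 ≤ ε
  dissipative_left : ∀ v, ⟪A v, v⟫_ℝ ≤ 0
  dissipative_right : ∀ v, ⟪B v, v⟫_ℝ ≤ 0
  add_apply : ∀ y, A (G y) + B (G y) = y
  norm_proj_le : ∀ x, ‖P x‖ ≤ K * ‖x‖
  norm_left_le : ∀ y, ‖A (G y)‖ ≤ K * ‖y‖
  elliptic_error : ∀ v ∈ domPow E (q + 1),
    ‖G (P (act E v)) - P v‖ ≤ K * ε * ∑ i ∈ Finset.Icc 1 (q + 1), ‖powAct E i v‖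

/-- The shift `l = 1` trades one more power of `E` for a factor `a`, for instance `a = k` for the
increment `T k v - v`. -/
theorem sum_Icc_one_le {f g : ℕ → ℝ} {m n : ℕ} {M a : ℝ} (ha : 0 ≤ a) (hg : ∀ i, 0 ≤ g i)
    (hgM : ∑ i ∈ Finset.Icc 1 n, g i ≤ M) (l : ℕ) (hmn : m + l ≤ n)
    (hfg : ∀ i ∈ Finset.Icc 1 m, f i ≤ a * g (i + l)) : ∑ i ∈ Finset.Icc 1 m, f i ≤ a * M := by
  refine (Finset.sum_le_sum hfg).trans ?_
  rw [← Finset.mul_sum]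
  refine mul_le_mul_of_nonneg_left (le_trans ?_ hgM) ha
  have e := Finset.sum_map (Finset.Icc 1 m) (addRightEmbedding l) g
  simp only [addRightEmbedding_apply] at e
  rw [← e, Finset.map_add_right_Icc]
  exact Finset.sum_le_sum_of_subset_of_nonneg (Finset.Icc_subset_Icc (by omega) hmn)
    fun i _ _ => hg i

theorem le_of_sum_Icc_one_le {g : ℕ → ℝ} {n : ℕ} {M : ℝ} (hg : ∀ i, 0 ≤ g i)
    (hgM : ∑ i ∈ Finset.Icc 1 n, g i ≤ M) {i : ℕ} (h1 : 1 ≤ i) (hn : i ≤ n) : g i ≤ M :=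
  (Finset.single_le_sum (fun i _ => hg i) (Finset.mem_Icc.2 ⟨h1, hn⟩)).trans hgM

namespace IsLinearDiscretization

variable {E : H →ₗ.[ℝ] H} {q : ℕ} {A B G : Module.End ℝ V} {P : H →ₗ[ℝ] V} {K ε : ℝ}

theorem right_apply (hD : IsLinearDiscretization E q A B G P K ε) (y : V) :
    B (G y) = y - A (G y) :=
  eq_sub_of_add_eq' (hD.add_apply y)

theorem norm_right_le (hD : IsLinearDiscretization E q A B G P K ε) (y : V) :
    ‖B (G y)‖ ≤ (1 + K) * ‖y‖ := by
  rw [hD.right_apply]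
  linarith [norm_sub_le y (A (G y)), hD.norm_left_le y]

variable [CompleteSpace H] {T : ℝ → H →L[ℝ] H}

/-- With `Q = G P E` and `x = T k v - v`, applying `(I - kA)(I - kB)` to the local error gives `g +
kA f`, where `g = Q x - k P E T k v` and `f = k B Q x`. Adding and subtracting `P x` splits `g` into
an elliptic error and the implicit Euler defect. -/
theorem local_error_DR (hD : IsLinearDiscretization E q A B G P K ε) (hE : IsMaximalDissipative E)
    (hT : IsGeneratorOf E T) {k M : ℝ} (hk : 0 ≤ k) {v : H} (hv : v ∈ domPow E (q + 2))
    (hM : ∑ i ∈ Finset.Icc 1 (q + 2), ‖powAct E i v‖ ≤ M) {y : V}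
    (hy : (y - k • B y) - k • A (y - k • B y) =
      G (P (act E v)) + k ^ 2 • A (B (G (P (act E v))))) :
    ‖(G (P (act E (T k v))) - y) - k • B (G (P (act E (T k v))) - y)‖ ≤
      3 * K * (1 + K) * k * (ε + k ^ 1) * M := by
  have hK := hD.nonneg
  have hε := hD.eps_nonneg
  have hTv := hT.apply_mem_domPow hv hk
  set x := T k v - v with hx
  have hxm : x ∈ domPow E (q + 2) := sub_mem_domPow hTv hv
  have hpow : ∀ i ≤ q + 2, powAct E i x = T k (powAct E i v) - powAct E i v := fun i hi => by
    rw [hx, powAct_sub hTv hv hi, hT.powAct_apply hv hi hk]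
  have hdiff : ∀ i < q + 2, ‖powAct E i x‖ ≤ k * ‖powAct E (i + 1) v‖ := fun i hi => by
    rw [hpow i hi.le, mul_comm]
    exact hT.norm_apply_sub_le hE hk (mem_graph_powAct hv hi)
  have hterm : ∀ {i}, 1 ≤ i → i ≤ q + 2 → ‖powAct E i v‖ ≤ M := fun h1 h2 =>
    le_of_sum_Icc_one_le (g := fun i => ‖powAct E i v‖) (fun _ => norm_nonneg _) hM h1 h2
  have hM0 : 0 ≤ M := (norm_nonneg _).trans (hterm le_rfl (by omega))
  have hactTv : act E (T k v) = T k (act E v) := hT.powAct_apply hv (i := 1) (by omega) hk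
  have hactx : act E x = act E (T k v) - act E v := powAct_sub hTv hv (i := 1) (by omega)
  have hQx : G (P (act E x)) = G (P (act E (T k v))) - G (P (act E v)) := by
    rw [hactx, map_sub, map_sub]
  set g := (G (P (act E x)) - P x) + P (x - k • T k (act E v))
  have hg : ‖g‖ ≤ K * ε * (k * M) + K * (M * k ^ 2) := by
    refine norm_add_le_of_le ((hD.elliptic_error x (domPow_anti (by omega) hxm)).trans ?_)
      ((hD.norm_proj_le _).trans ?_)
    · refine mul_le_mul_of_nonneg_left ?_ (by positivity)
      refine sum_Icc_one_le (g := fun i => ‖powAct E i v‖) hk (fun _ => norm_nonneg _) hM 1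
        (by omega) fun i hi => hdiff i ?_
      have := (Finset.mem_Icc.1 hi).2
      omega
    · refine mul_le_mul_of_nonneg_left ((hT.norm_apply_sub_sub_smul_le hE hk
        (mem_graph_powAct hv (i := 0) (by omega)) (mem_graph_powAct hv (i := 1) (by omega))).trans
        (mul_le_mul_of_nonneg_right (hterm (by omega) (by omega)) (by positivity))) hK
  have hf : ‖k • B (G (P (act E x)))‖ ≤ k * ((1 + K) * (K * (k * M))) := by
    rw [norm_smul, Real.norm_of_nonneg hk]
    refine mul_le_mul_of_nonneg_left ((hD.norm_right_le _).trans
      (mul_le_mul_of_nonneg_left ((hD.norm_proj_le _).trans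
        (mul_le_mul_of_nonneg_left ?_ hK)) (by positivity))) hk
    exact (hdiff 1 (by omega)).trans
      (mul_le_mul_of_nonneg_left (hterm (by omega) (by omega)) hk)
  have key := norm_le_of_sub_smul_eq hD.dissipative_left hk
    (x := (G (P (act E (T k v))) - y) - k • B (G (P (act E (T k v))) - y)) (g := g)
    (f := k • B (G (P (act E x)))) ?_
  · refine key.trans ((add_le_add hg (mul_le_mul_of_nonneg_left hf zero_le_two)).trans ?_)
    have h1 : 0 ≤ K * k * M := by positivity
    have h2 : 0 ≤ K * K * k * M := by positivity
    nlinarith [mul_nonneg h1 hε, mul_nonneg h2 hε, mul_nonneg h1 hk, mul_nonneg h2 hk]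
  · have e := hD.add_apply (P (act E (T k v)))
    have e1 : A (G (P (act E (T k v)))) = P (act E (T k v)) - B (G (P (act E (T k v)))) :=
      eq_sub_of_add_eq e
    have e2 : ∀ a : V, (a - y) - k • B (a - y) - k • A ((a - y) - k • B (a - y)) =
        ((a - k • B a) - k • A (a - k • B a)) - ((y - k • B y) - k • A (y - k • B y)) := fun a => by
      simp only [map_sub, map_smul]; module
    have e3 : g = G (P (act E x)) - k • P (act E (T k v)) := by
      simp only [g, hactTv, map_sub, map_smul]; abel
    rw [e2, hy, e3, hQx]
    simp only [map_sub, map_smul, e1]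
    module

/-- The remainder is now `(k/2)² A B Q x`, of which one order more is required. Splitting `P E x =
Q₂ + (P E x - Q₂)` with `Q₂ = Q (E x)` makes the second part an elliptic error, placed under `A` as
`f₁`. The first part is `f₂`, bounded through `A G` and `A² G²` by `‖E² x‖ = O(k)`. -/
theorem local_error_PR (hD : IsLinearDiscretization E q A B G P K ε) (hE : IsMaximalDissipative E)
    (hT : IsGeneratorOf E T) (hAA : ∀ y, ‖A (A (G (G y)))‖ ≤ K * ‖y‖)
    {k M : ℝ} (hk : 0 ≤ k) {v : H} (hv : v ∈ domPow E (q + 3))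
    (hM : ∑ i ∈ Finset.Icc 1 (q + 3), ‖powAct E i v‖ ≤ M) {y : V}
    (hy : (y - (k / 2) • B y) - (k / 2) • A (y - (k / 2) • B y) =
      (G (P (act E v)) + (k / 2) • B (G (P (act E v)))) +
        (k / 2) • A (G (P (act E v)) + (k / 2) • B (G (P (act E v))))) :
    ‖(G (P (act E (T k v))) - y) - (k / 2) • B (G (P (act E (T k v))) - y)‖ ≤
      3 * K * (1 + K) * k * (ε + k ^ 2) * M := by
  have hK := hD.nonneg
  have hε := hD.eps_nonneg
  have hTv := hT.apply_mem_domPow hv hk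
  set x := T k v - v with hx
  have hxm : x ∈ domPow E (q + 3) := sub_mem_domPow hTv hv
  have hpow : ∀ i ≤ q + 3, powAct E i x = T k (powAct E i v) - powAct E i v := fun i hi => by
    rw [hx, powAct_sub hTv hv hi, hT.powAct_apply hv hi hk]
  have hdiff : ∀ i < q + 3, ‖powAct E i x‖ ≤ k * ‖powAct E (i + 1) v‖ := fun i hi => by
    rw [hpow i hi.le, mul_comm]
    exact hT.norm_apply_sub_le hE hk (mem_graph_powAct hv hi)
  have hbd : ∀ i ≤ q + 3, ‖powAct E i x‖ ≤ 2 * ‖powAct E i v‖ := fun i hi => by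
    rw [hpow i hi, two_mul]
    exact norm_sub_le_of_le (hT.norm_apply_le hE hk _) le_rfl
  have hterm : ∀ {i}, 1 ≤ i → i ≤ q + 3 → ‖powAct E i v‖ ≤ M := fun h1 h2 =>
    le_of_sum_Icc_one_le (g := fun i => ‖powAct E i v‖) (fun _ => norm_nonneg _) hM h1 h2
  have hM0 : 0 ≤ M := (norm_nonneg _).trans (hterm le_rfl (by omega))
  have hactTv : act E (T k v) = T k (act E v) := hT.powAct_apply hv (i := 1) (by omega) hk
  have hactx : act E x = act E (T k v) - act E v := powAct_sub hTv hv (i := 1) (by omega)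
  have hQx : G (P (act E x)) = G (P (act E (T k v))) - G (P (act E v)) := by
    rw [hactx, map_sub, map_sub]
  set g := (G (P (act E x)) - P x) + P (x - (k / 2) • (T k (act E v) + act E v))
  have hg : ‖g‖ ≤ K * ε * (k * M) + K * (M * k ^ 3) := by
    refine norm_add_le_of_le ((hD.elliptic_error x (domPow_anti (by omega) hxm)).trans ?_)
      ((hD.norm_proj_le _).trans ?_)
    · refine mul_le_mul_of_nonneg_left ?_ (by positivity)
      refine sum_Icc_one_le (g := fun i => ‖powAct E i v‖) hk (fun _ => norm_nonneg _) hM 1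
        (by omega) fun i hi => hdiff i ?_
      have := (Finset.mem_Icc.1 hi).2
      omega
    · refine mul_le_mul_of_nonneg_left ((hT.norm_apply_sub_sub_smul_add_le hE hk
        (mem_graph_powAct hv (i := 0) (by omega)) (mem_graph_powAct hv (i := 1) (by omega))
        (mem_graph_powAct hv (i := 2) (by omega))).trans
        (mul_le_mul_of_nonneg_right (hterm (by omega) (by omega)) (by positivity))) hK
  set Q₂ := G (P (act E (act E x)))
  set f₁ := (k / 2) • (P (act E x) - Q₂ - A (G (P (act E x) - Q₂)))
  set f₂ := (k / 2) ^ 2 • (A Q₂ - A (A (G Q₂)))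
  have hf₁ : ‖f₁‖ ≤ k / 2 * ((1 + K) * (K * ε * (2 * M))) := by
    rw [norm_smul, Real.norm_of_nonneg (by positivity), ← hD.right_apply]
    refine mul_le_mul_of_nonneg_left ((hD.norm_right_le _).trans
      (mul_le_mul_of_nonneg_left ?_ (by positivity))) (by positivity)
    rw [norm_sub_rev]
    refine (hD.elliptic_error (act E x)
      (domPow_anti (by omega) (act_mem_domPow hxm))).trans ?_
    refine mul_le_mul_of_nonneg_left ?_ (by positivity)
    refine sum_Icc_one_le (g := fun i => ‖powAct E i v‖) zero_le_two (fun _ => norm_nonneg _) hM 1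
      (by omega) fun i hi => hbd (i + 1) ?_
    have := (Finset.mem_Icc.1 hi).2
    omega
  have hf₂ : ‖f₂‖ ≤ (k / 2) ^ 2 * (K * (K * (k * M)) + K * (K * (k * M))) := by
    have h1 : ‖P (act E (act E x))‖ ≤ K * (k * M) :=
      (hD.norm_proj_le _).trans (mul_le_mul_of_nonneg_left ((hdiff 2 (by omega)).trans
        (mul_le_mul_of_nonneg_left (hterm (by omega) (by omega)) hk)) hK)
    rw [norm_smul, Real.norm_of_nonneg (by positivity)]
    refine mul_le_mul_of_nonneg_left (norm_sub_le_of_le ?_ ?_) (by positivity)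
    · exact (hD.norm_left_le _).trans (mul_le_mul_of_nonneg_left h1 hK)
    · exact (hAA _).trans (mul_le_mul_of_nonneg_left h1 hK)
  have key := norm_le_of_sub_smul_eq hD.dissipative_left (by positivity : 0 ≤ k / 2)
    (x := (G (P (act E (T k v))) - y) - (k / 2) • B (G (P (act E (T k v))) - y)) (g := g + f₂)
    (f := f₁) ?_
  · refine key.trans ((add_le_add (norm_add_le_of_le hg hf₂)
      (mul_le_mul_of_nonneg_left hf₁ zero_le_two)).trans ?_)
    have h1 : 0 ≤ K * k * M := by positivity
    have h2 : 0 ≤ K * K * k * M := by positivity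
    nlinarith [mul_nonneg h1 hε, mul_nonneg h2 hε, mul_nonneg h1 (sq_nonneg k),
      mul_nonneg h2 (sq_nonneg k)]
  · have e1 : ∀ z, B (G z) = z - A (G z) := hD.right_apply
    have e2 : ∀ a : V, (a - y) - (k / 2) • B (a - y) - (k / 2) • A ((a - y) - (k / 2) • B (a - y)) =
        ((a - (k / 2) • B a) - (k / 2) • A (a - (k / 2) • B a)) -
          ((y - (k / 2) • B y) - (k / 2) • A (y - (k / 2) • B y)) := fun a => by
      simp only [map_sub, map_smul]; module
    have e3 : g = G (P (act E x)) - (k / 2) • (P (act E (T k v)) + P (act E v)) := by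
      simp only [g, hactTv, map_sub, map_add, map_smul]; abel
    have e4 : P (act E x) = P (act E (T k v)) - P (act E v) := by rw [hactx, map_sub]
    rw [e2, hy, e3, hQx]
    simp only [f₁, f₂, map_sub, map_add, map_smul, e1, e4]
    module

end IsLinearDiscretization

end LinearDiscretization

/-! ### Global error: accumulation of local errors -/

section GlobalError

variable {H : Type*} [NormedAddCommGroup H] [InnerProductSpace ℝ H] [CompleteSpace H]
  {V : Type*} [NormedAddCommGroup V] [InnerProductSpace ℝ V]
  {E : H →ₗ.[ℝ] H} {q : ℕ} {A B G : Module.End ℝ V} {P : H →ₗ[ℝ] V} {K ε : ℝ} {T : ℝ → H →L[ℝ] H}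

/-- The constant in the global error bound up to time `t`. -/
def errorConst (K t : ℝ) : ℝ := K + K * (t * (3 * K * (1 + K)) + K * K + t * (1 + K) * K)

/-- Stability and a local error bound imply convergence. -/
theorem IsLinearDiscretization.norm_sub_pow_apply_le (hD : IsLinearDiscretization E q A B G P K ε)
    (hE : IsMaximalDissipative E) (hT : IsGeneratorOf E T) {ι : V →ₗ[ℝ] H}
    (hι : ∀ v, ‖ι v‖ ≤ K * ‖v‖) (hG : ∀ y, ‖G y‖ ≤ K * ‖y‖)
    (hell : ∀ v ∈ domPow E (q + 1), ‖v - ι (G (P (act E v)))‖ ≤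
      K * ε * ∑ i ∈ Finset.Icc 1 (q + 1), ‖powAct E i v‖)
    {c k t : ℝ} (hc : 0 ≤ c) (hk : c ≤ k) {S : Module.End ℝ V}
    (hS : ∀ x, ‖S x - c • B (S x)‖ ≤ ‖x - c • B x‖) {n : ℕ} (hn : n * k ≤ t) {r : ℕ} {η : H}
    (hη : η ∈ domPow E (q + r + 1)) {p : V}
    (hp : ‖P (act E η) - p‖ ≤ K * ε * ∑ i ∈ Finset.Icc 1 (q + 1), ‖powAct E i η‖)
    (hloc : ∀ v ∈ domPow E (q + r + 1), ∀ M, ∑ i ∈ Finset.Icc 1 (q + r + 1), ‖powAct E i v‖ ≤ M →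
      ‖(G (P (act E (T k v))) - S (G (P (act E v)))) -
        c • B (G (P (act E (T k v))) - S (G (P (act E v))))‖ ≤
          3 * K * (1 + K) * k * (ε + k ^ r) * M) :
    ‖T (n * k) η - ι ((S ^ n) (G p))‖ ≤
      errorConst K t * (ε + k ^ r) * ∑ i ∈ Finset.Icc 1 (q + r + 1), ‖powAct E i η‖ := by
  have hK := hD.nonneg
  have hε := hD.eps_nonneg
  have hk0 : 0 ≤ k := hc.trans hk
  have hnk : 0 ≤ n * k := by positivity
  have ht : 0 ≤ t := hnk.trans hn
  set M := ∑ i ∈ Finset.Icc 1 (q + r + 1), ‖powAct E i η‖ with hMdef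
  have hM0 : 0 ≤ M := Finset.sum_nonneg fun _ _ => norm_nonneg _
  have hTη : ∀ {s : ℝ}, 0 ≤ s → ∀ m ≤ q + r + 1,
      ∑ i ∈ Finset.Icc 1 m, ‖powAct E i (T s η)‖ ≤ M := fun {s} hs m hm => by
    refine (sum_Icc_one_le (g := fun i => ‖powAct E i η‖) zero_le_one (fun _ => norm_nonneg _)
      le_rfl 0 hm fun i hi => ?_).trans_eq (one_mul M)
    rw [hT.powAct_apply hη ((Finset.mem_Icc.1 hi).2.trans hm) hs, one_mul]
    exact hT.norm_apply_le hE hs _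
  have hp' : ‖P (act E η) - p‖ ≤ K * ε * M := hp.trans (mul_le_mul_of_nonneg_left
    (by simpa [hT.apply_zero] using hTη le_rfl (q + 1) (by omega)) (by positivity))
  have h1 : ‖T (n * k) η - ι (G (P (act E (T (n * k) η))))‖ ≤ K * ε * M :=
    (hell _ (domPow_anti (by omega) (hT.apply_mem_domPow hη hnk))).trans
      (mul_le_mul_of_nonneg_left (hTη hnk _ (by omega)) (by positivity))
  set u : ℕ → V := fun j => G (P (act E (T (j * k) η))) with hu
  have h2 : ‖u n - (S ^ n) (u 0)‖ ≤ n * (3 * K * (1 + K) * k * (ε + k ^ r) * M) := by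
    refine SplittingFE.norm_sub_pow_apply_le hD.dissipative_right hc hS (fun j => ?_) n
    have hjk : 0 ≤ (j : ℝ) * k := by positivity
    have e : T ((j + 1 : ℕ) * k) η = T k (T (j * k) η) := by
      have := hT.semigroup.add k (j * k) hk0 hjk
      rw [Nat.cast_succ, add_mul, one_mul, add_comm, this]; rfl
    simp only [hu, e]
    exact hloc _ (hT.apply_mem_domPow hη hjk) M (hTη hjk _ le_rfl)
  have hu0 : u 0 - G p = G (P (act E η) - p) := by
    simp [hu, hT.apply_zero]
  -- The initial values differ by `G` applied to a small vector, and `B G` is bounded. So the term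
  -- with `B` in the power bound is harmless.
  have h3 : ‖(S ^ n) (u 0) - (S ^ n) (G p)‖ ≤ K * (K * ε * M) + t * ((1 + K) * (K * ε * M)) := by
    rw [← map_sub, hu0]
    refine (norm_pow_apply_le hD.dissipative_right hc hS n _).trans (add_le_add
      ((hG _).trans (mul_le_mul_of_nonneg_left hp' hK)) (mul_le_mul
        ((mul_le_mul_of_nonneg_left hk (Nat.cast_nonneg n)).trans hn)
        ((hD.norm_right_le _).trans (mul_le_mul_of_nonneg_left hp' (by positivity)))
        (norm_nonneg _) ht))
  have h4 : ‖ι (u n - (S ^ n) (G p))‖ ≤ K * (n * (3 * K * (1 + K) * k * (ε + k ^ r) * M) +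
      (K * (K * ε * M) + t * ((1 + K) * (K * ε * M)))) := by
    refine (hι _).trans (mul_le_mul_of_nonneg_left ?_ hK)
    rw [← sub_add_sub_cancel _ ((S ^ n) (u 0))]
    exact norm_add_le_of_le h2 h3
  have e : T (n * k) η - ι ((S ^ n) (G p)) =
      (T (n * k) η - ι (u n)) + ι (u n - (S ^ n) (G p)) := by rw [map_sub]; abel
  rw [e]
  refine (norm_add_le_of_le h1 h4).trans ?_
  have hkr : 0 ≤ k ^ r := by positivity
  have h5 : n * (3 * K * (1 + K) * k * (ε + k ^ r) * M) ≤ t * (3 * K * (1 + K) * (ε + k ^ r) * M) := by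
    calc n * (3 * K * (1 + K) * k * (ε + k ^ r) * M)
        = n * k * (3 * K * (1 + K) * (ε + k ^ r) * M) := by ring
      _ ≤ _ := mul_le_mul_of_nonneg_right hn (by positivity)
  have h6 : K * ε * M ≤ K * (ε + k ^ r) * M := by
    gcongr; linarith
  calc _ ≤ K * (ε + k ^ r) * M + K * (t * (3 * K * (1 + K) * (ε + k ^ r) * M) +
      (K * (K * (ε + k ^ r) * M) + t * ((1 + K) * (K * (ε + k ^ r) * M)))) := by gcongr
    _ = _ := by rw [errorConst]; ring

end GlobalError

/-! ### From the spatial assumptions to a linear discretization -/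

namespace SpatialDiscretization

variable {H : Type*} [NormedAddCommGroup H] [InnerProductSpace ℝ H] {hmax : ℝ}
  (D : SpatialDiscretization H hmax) (h : Set.Ioc (0 : ℝ) hmax)

/-- The normed group `(H_h, ‖·‖_h)`. -/
abbrev normedAddCommGroup : NormedAddCommGroup (D.space h) := (D.ip h).toNormedAddCommGroup

/-- The inner product space `(H_h, (·,·)_h)`. -/
abbrev innerProductSpace :
    @InnerProductSpace ℝ (D.space h) _ (D.normedAddCommGroup h).toSeminormedAddCommGroup :=
  InnerProductSpace.ofCore (D.ip h).toCore

theorem L_mul_Linv (hL : IsUnit (M := Module.End ℝ (D.space h)) (D.L h)) (y : D.space h) :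
    D.A h (D.Linv h y) + D.B h (D.Linv h y) = y :=
  DFunLike.congr_fun (Ring.mul_inverse_cancel _ hL) y

/-- The orthogonal projection of `H` onto `H_h`. -/
def proj : H →ₗ[ℝ] D.space h :=
  have := D.finiteDimensional h
  ((D.space h).orthogonalProjectionOnto : H →ₗ[ℝ] D.space h)

theorem norm_proj_le (x : H) : ‖(D.proj h x : H)‖ ≤ ‖x‖ :=
  have := D.finiteDimensional h
  (D.space h).norm_orthogonalProjectionOnto_apply_le x

theorem norm_sub_proj_le (x : H) (y : D.space h) : ‖x - D.proj h x‖ ≤ ‖x - y‖ := by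
  have := D.finiteDimensional h
  have := (D.space h).starProjection_minimal x
  rw [Submodule.starProjection_apply] at this
  exact this.trans_le (ciInf_le ⟨0, by rintro _ ⟨z, rfl⟩; exact norm_nonneg _⟩ y)

/-- Replacing the mappings `P_h` by orthogonal projections yields linear discretizations, with
constants independent of `h`. -/
theorem SpaceAssumption.exists_isLinearDiscretization {D : SpatialDiscretization H hmax}
    {E : H →ₗ.[ℝ] H} {s : ℝ} {q : ℕ} (hD : D.SpaceAssumption E s q) (hE : IsInvertible E) {C₃ : ℝ}
    (hC₃ : ∀ h, D.OpNormLE h (D.A h ∘ₗ D.Linv h) C₃) :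
    ∃ K, C₃ ≤ K ∧ ∀ h,
      @IsLinearDiscretization H _ _ (D.space h) (D.normedAddCommGroup h) (D.innerProductSpace h)
        E q (D.A h) (D.B h) (D.Linv h) (D.proj h) K ((h : ℝ) ^ s) ∧
      (∀ v : D.space h, ‖(v : H)‖ ≤ K * D.normh h v) ∧
      (∀ y, D.normh h (D.Linv h y) ≤ K * D.normh h y) ∧
      ∀ v ∈ domPow E (q + 1),
        (‖v - (D.Linv h (D.proj h (act E v)) : H)‖ ≤
          K * (h : ℝ) ^ s * ∑ i ∈ Finset.Icc 1 (q + 1), ‖powAct E i v‖) ∧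
        D.normh h (D.proj h (act E v) - D.P h (act E v)) ≤
          K * (h : ℝ) ^ s * ∑ i ∈ Finset.Icc 1 (q + 1), ‖powAct E i v‖ := by
  obtain ⟨c₁, c₂, hc₁, hc₂, hnorm⟩ := hD.norm_equiv
  obtain ⟨Cp, hCp⟩ := hD.projection
  obtain ⟨Ci, hCi⟩ := hD.inverse_bounded
  obtain ⟨Ce, hCe⟩ := hD.elliptic_error
  -- nonnegative versions of the constants
  set p := |Cp|
  set i₀ := |Ci|
  set e := |Ce|
  have hp0 : 0 ≤ p := abs_nonneg _
  have hi0 : 0 ≤ i₀ := abs_nonneg _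
  have he0 : 0 ≤ e := abs_nonneg _
  -- `a` bounds `Π - P_h`: the projection is at least as close as `P_h`, hence the `2`. `b` bounds
  -- the elliptic error once `P_h` is replaced by `Π`.
  set a := 2 * c₂ * p with ha
  set b := e + c₁⁻¹ * i₀ * a with hb
  have ha0 : 0 ≤ a := by positivity
  have hb0 : 0 ≤ b := by positivity
  have hc10 : 0 ≤ c₁⁻¹ := by positivity
  set K := |C₃| + c₁⁻¹ + c₂ + i₀ + a + b + c₂ * (2 * b)
  have hcb : 0 ≤ c₂ * (2 * b) := by positivity
  have hC₃0 := abs_nonneg C₃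
  refine ⟨K, by linarith [le_abs_self C₃], fun h => ?_⟩
  have hhs : 0 ≤ (h : ℝ) ^ s := Real.rpow_nonneg h.2.1.le s
  have hn0 : ∀ v : D.space h, 0 ≤ D.normh h v := fun v => Real.sqrt_nonneg _
  have hlow : ∀ v : D.space h, ‖(v : H)‖ ≤ c₁⁻¹ * D.normh h v := fun v => by
    rw [← div_eq_inv_mul, le_div_iff₀' hc₁]; exact (hnorm h v).1
  have hsum : ∀ v, ∑ i ∈ Finset.range (q + 1), ‖powAct E i (act E v)‖ =
      ∑ i ∈ Finset.Icc 1 (q + 1), ‖powAct E i v‖ := fun v => by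
    rw [Finset.range_eq_Ico]
    exact Finset.sum_Ico_add' (fun i => ‖powAct E i v‖) 0 (q + 1) 1
  have hs0 : ∀ v, 0 ≤ ∑ i ∈ Finset.Icc 1 (q + 1), ‖powAct E i v‖ := fun v =>
    Finset.sum_nonneg fun _ _ => norm_nonneg _
  have hPP : ∀ v ∈ domPow E (q + 1), D.normh h (D.proj h (act E v) - D.P h (act E v)) ≤
      a * (h : ℝ) ^ s * ∑ i ∈ Finset.Icc 1 (q + 1), ‖powAct E i v‖ := by
    intro v hv
    have h1 := hCp h _ (act_mem_domPow hv)
    rw [hsum] at h1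
    have h2 : ‖(D.P h (act E v) : H) - act E v‖ ≤
        p * ((h : ℝ) ^ s * ∑ i ∈ Finset.Icc 1 (q + 1), ‖powAct E i v‖) := by
      rw [mul_assoc] at h1
      exact h1.trans (mul_le_mul_of_nonneg_right (le_abs_self _) (mul_nonneg hhs (hs0 v)))
    have h3 := D.norm_sub_proj_le h (act E v) (D.P h (act E v))
    rw [norm_sub_rev] at h2
    have h4 := norm_sub_le_norm_sub_add_norm_sub (D.proj h (act E v) : H) (act E v)
      (D.P h (act E v))
    rw [norm_sub_rev _ (act E v)] at h4
    refine (hnorm h _).2.trans ?_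
    rw [Submodule.coe_sub, ha]
    calc c₂ * _ ≤ c₂ * (2 * (p * ((h : ℝ) ^ s * ∑ i ∈ Finset.Icc 1 (q + 1), ‖powAct E i v‖))) := by
          gcongr; linarith
      _ = _ := by ring
  have hLinv : ∀ y, D.normh h (D.Linv h y) ≤ i₀ * D.normh h y := fun y =>
    (hCi h y).trans (mul_le_mul_of_nonneg_right (le_abs_self _) (hn0 y))
  have hell : ∀ v ∈ domPow E (q + 1), ‖v - (D.Linv h (D.proj h (act E v)) : H)‖ ≤
      b * (h : ℝ) ^ s * ∑ i ∈ Finset.Icc 1 (q + 1), ‖powAct E i v‖ := by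
    intro v hv
    have h1 := hCe h _ (act_mem_domPow hv)
    rw [hsum, hE.act_inverse (mem_graph_act (x := v) (hv 0 (by omega))), mul_assoc] at h1
    have h2 := h1.trans (mul_le_mul_of_nonneg_right (le_abs_self Ce) (mul_nonneg hhs (hs0 v)))
    have h3 := hlow (D.Linv h (D.proj h (act E v) - D.P h (act E v)))
    have h4 : ‖(D.Linv h (D.proj h (act E v) - D.P h (act E v)) : H)‖ ≤
        c₁⁻¹ * (i₀ * (a * (h : ℝ) ^ s * ∑ i ∈ Finset.Icc 1 (q + 1), ‖powAct E i v‖)) :=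
      h3.trans (mul_le_mul_of_nonneg_left ((hLinv _).trans
        (mul_le_mul_of_nonneg_left (hPP v hv) hi0)) hc10)
    have h5 : v - (D.Linv h (D.proj h (act E v)) : H) = (v - (D.Linv h (D.P h (act E v)) : H)) -
        (D.Linv h (D.proj h (act E v) - D.P h (act E v)) : H) := by
      rw [map_sub, Submodule.coe_sub]; abel
    rw [h5]
    refine (norm_sub_le_of_le h2 h4).trans_eq ?_
    rw [hb]; ring
  have hmono : ∀ {x : ℝ}, x ≤ K → ∀ v, x * (h : ℝ) ^ s * ∑ i ∈ Finset.Icc 1 (q + 1), ‖powAct E i v‖ ≤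
      K * (h : ℝ) ^ s * ∑ i ∈ Finset.Icc 1 (q + 1), ‖powAct E i v‖ := fun hx v =>
    mul_le_mul_of_nonneg_right (mul_le_mul_of_nonneg_right hx hhs) (hs0 v)
  refine ⟨?_, fun v => (hlow v).trans (mul_le_mul_of_nonneg_right (by linarith) (hn0 v)),
    fun y => (hLinv y).trans (mul_le_mul_of_nonneg_right (by linarith) (hn0 y)),
    fun v hv => ⟨(hell v hv).trans (hmono (by linarith) v),
      (hPP v hv).trans (hmono (by linarith) v)⟩⟩
  refine @IsLinearDiscretization.mk H _ _ (D.space h) (D.normedAddCommGroup h)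
    (D.innerProductSpace h) E q (D.A h) (D.B h) (D.Linv h) (D.proj h) K ((h : ℝ) ^ s)
    (by linarith) hhs (hD.dissipative h).1 (hD.dissipative h).2
    (D.L_mul_Linv h (hD.invertible h)) (fun x => ?_) (fun y => ?_) (fun v hv => ?_)
  · refine (hnorm h _).2.trans ?_
    exact mul_le_mul (by linarith) (D.norm_proj_le h x) (norm_nonneg _) (by linarith)
  · exact (hC₃ h y).trans (mul_le_mul_of_nonneg_right (by linarith [le_abs_self C₃]) (hn0 y))
  -- `G Π E v` lies in `H_h`, so `Π v` is at least as close to `v`. Their distance is at most twice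
  -- the elliptic error.
  · refine le_trans ?_ (hmono (x := c₂ * (2 * b)) (by linarith) v)
    refine (hnorm h _).2.trans ?_
    have h1 := hell v hv
    have h2 := D.norm_sub_proj_le h v (D.Linv h (D.proj h (act E v)))
    have h3 := norm_sub_le_norm_sub_add_norm_sub (D.Linv h (D.proj h (act E v)) : H) v
      (D.proj h v)
    rw [norm_sub_rev _ v] at h3
    rw [AddSubgroupClass.coe_sub]
    calc c₂ * _ ≤ c₂ * (2 * (b * (h : ℝ) ^ s * ∑ i ∈ Finset.Icc 1 (q + 1), ‖powAct E i v‖)) := by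
          gcongr; linarith
      _ = _ := by ring

end SpatialDiscretization

end SplittingFE

end

/-! ### The convergence theorem -/

theorem mainTheorem1 {H : Type*} [NormedAddCommGroup H] [InnerProductSpace ℝ H] [CompleteSpace H]
    (L : H →ₗ.[ℝ] H) (hL : SplittingFE.IsMaximalDissipative L)
    (hLinv : SplittingFE.IsInvertible L)
    (hmax : ℝ) (D : SplittingFE.SpatialDiscretization H hmax)
    (s : ℝ) (hs : 0 < s) (q : ℕ) (hq : q = 0 ∨ q = 1)
    (hD : D.SpaceAssumption L s q) :
    (D.StabilityDR →
      ∀ tmax : ℝ, ∃ C : ℝ, ∀ (h : Set.Ioc (0 : ℝ) hmax) (k : ℝ) (n : ℕ),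
        0 < k → n * k ≤ tmax → ∀ η ∈ SplittingFE.domPow L (q + 1 + 1),
          ‖SplittingFE.expSemigroup L (n * k) η - ((D.stepDR h k ^ n) (D.Q h L η) : H)‖ ≤
            C * ((h : ℝ) ^ s + k ^ 1) *
              ∑ i ∈ Finset.Icc 1 (q + 1 + 1), ‖SplittingFE.powAct L i η‖) ∧
    (D.StabilityPR →
      ∀ tmax : ℝ, ∃ C : ℝ, ∀ (h : Set.Ioc (0 : ℝ) hmax) (k : ℝ) (n : ℕ),
        0 < k → n * k ≤ tmax → ∀ η ∈ SplittingFE.domPow L (q + 2 + 1),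
          ‖SplittingFE.expSemigroup L (n * k) η - ((D.stepPR h k ^ n) (D.Q h L η) : H)‖ ≤
            C * ((h : ℝ) ^ s + k ^ 2) *
              ∑ i ∈ Finset.Icc 1 (q + 2 + 1), ‖SplittingFE.powAct L i η‖) := by
  have hT : SplittingFE.IsGeneratorOf L (SplittingFE.expSemigroup L) := by
    rw [SplittingFE.expSemigroup, dif_pos hL.exists_isGeneratorOf]
    exact hL.exists_isGeneratorOf.choose_spec
  refine ⟨fun ⟨C₃, hC₃⟩ tmax => ?_, fun ⟨C₃, hC₃⟩ tmax => ?_⟩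
  · obtain ⟨K, -, hK⟩ := hD.exists_isLinearDiscretization hLinv hC₃
    refine ⟨SplittingFE.errorConst K tmax, fun h k n hk hn η hη => ?_⟩
    obtain ⟨hlin, hι, hG, hell⟩ := hK h
    -- From here on norms on `H_h` are `‖·‖_h` and not those inherited from `H`; the inclusion `ι`
    -- mediates between the two.
    let _ := D.normedAddCommGroup h
    let _ := D.innerProductSpace h
    have := D.finiteDimensional h
    have hstep := SplittingFE.sub_smul_apply_stepDR (hD.dissipative h).1 (hD.dissipative h).2 hk.le
      (S := D.stepDR h k) rfl
    exact hlin.norm_sub_pow_apply_le hL hT (ι := (D.space h).subtype) hι hG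
      (fun v hv => (hell v hv).1) hk.le le_rfl
      (fun x => SplittingFE.norm_stepDR_le (hD.dissipative h).1 (hD.dissipative h).2 hk.le (hstep x))
      hn hη (hell η (SplittingFE.domPow_anti (by omega) hη)).2
      (fun v hv M hM => hlin.local_error_DR hL hT hk.le hv hM (hstep _))
  · obtain ⟨K, hC₃K, hK⟩ := hD.exists_isLinearDiscretization hLinv fun h => (hC₃ h).1
    refine ⟨SplittingFE.errorConst K tmax, fun h k n hk hn η hη => ?_⟩
    obtain ⟨hlin, hι, hG, hell⟩ := hK h
    let _ := D.normedAddCommGroup h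
    let _ := D.innerProductSpace h
    have := D.finiteDimensional h
    have hk2 : 0 ≤ k / 2 := by positivity
    have hstep := SplittingFE.sub_smul_apply_stepPR (hD.dissipative h).1 (hD.dissipative h).2 hk2
      (S := D.stepPR h k) rfl
    exact hlin.norm_sub_pow_apply_le hL hT (ι := (D.space h).subtype) hι hG
      (fun v hv => (hell v hv).1) hk2 (by linarith)
      (fun x => SplittingFE.norm_stepPR_le (hD.dissipative h).1 (hD.dissipative h).2 hk2 (hstep x))
      hn hη (hell η (SplittingFE.domPow_anti (by omega) hη)).2
      (fun v hv M hM => hlin.local_error_PR hL hT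
        -- The constant `K` was chosen to be at least `C₃`, so it also serves for `A_h² L_h⁻²`.
        (fun y => ((hC₃ h).2 y).trans (mul_le_mul_of_nonneg_right hC₃K (Real.sqrt_nonneg _)))
        hk.le hv hM (hstep _))
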